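/- Let $(X_1,Y_1),(X_2,Y_2),\dots$ be independent, identically distributed pairs of real random variables with joint density $g(s,t)\ge 0$. Put $f(s)=\int_{\mathbb R} g(s,t)\,dt$ (the density of $X$), $a(s)=\int_{\mathbb R} t\,g(s,t)\,dt$, $r(s)=a(s)/f(s)=\mathbb E[Y\mid X=s]$, and $\mathbb E[Y^2\mid X=s]=f(s)^{-1}\int_{\mathbb R}t^2g(s,t)\,dt$. Let $(\beta_n)_{n\ge1}$ and $(h_n)_{n\ge 1}$ be sequences of positive reals, let $\gamma_n=n^{-1}$, and fix $x\in\mathbb R$. Set $a_0(x)=f_0(x)=0$ and, for $n\ge1$, $$a_n(x)=(1-\beta_n)a_{n-1}(x)+\beta_nh_n^{-1}Y_nK\left(\frac{x-X_n}{h_n}\right),\qquad f_n(x)=(1-\gamma_n)f_{n-1}(x)+\gamma_nh_n^{-1}K\left(\frac{x-X_n}{h_n}\right),$$ and $r_n(x)=a_n(x)/f_n(x)$ if $f_n(x)\ne0$, $r_n(x)=0$ otherwise. For $\gamma\in\mathbb R$, a positive sequence $(v_n)_{n\ge1}$ is said to belong to $\mathcal{GS}(\gamma)$ if $\lim_{n\to\infty}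 n\left[1-v_{n-1}/v_n\right]=\gamma$. Assume the following. (A1) $K:\mathbb R\to\mathbb R$ is continuous and bounded, $K$ and $z^2K(z)$ are integrable, $\int K(z)\,dz=1$ and $\int zK(z)\,dz=0$. (A2) (i) $(\beta_n)\in\mathcal{GS}(-\beta)$ with $\beta\in(1/2,1]$; (ii) $(h_n)\in\mathcal{GS}(-a)$ with a number $a\in(0,1)$; (iii) $\lim_{n\to\infty}n\beta_n$ exists in $\left(\min\{2a,(\beta-a)/2\},\infty\right]$. (A3) (i) For every $t$, $s\mapsto g(s,t)$ is twice continuously differentiable. (ii) For $q\in\{0,1,2\}$, $s\mapsto\int t^qg(s,t)\,dt$ is a bounded function, continuous at $s=x$; for real $q\in[2,3]$, $s\mapsto\int|t|^qg(s,t)\,dt$ is a bounded function. (iii) For $q\in\{0,1\}$, $\int|t|^q\left|\frac{\partial g}{\partial s}(x,t)\right|dt<\infty$, and $s\mapsto\int t^q\frac{\partial^2g}{\partial s^2}(s,t)\,dt$ is a bounded function, continuous at $s=x$. Assume moreover that $f(x)>0$ and that $f$ and $a(\cdot)$ are twice differentiable at $x$, with second derivatives $f^{(2)}(x)$ and $a^{(2)}(x)$.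 Write $\xi=\lim_{n\to\infty}(n\beta_n)^{-1}$, $\mu_2(K)=\int z^2K(z)\,dz$, $R(K)=\int K^2(z)\,dz$, and $$B^{(1)}_{a,\xi}(x)=\frac1{2f(x)}\left(\frac{a^{(2)}(x)}{1-2a\xi}-\frac{r(x)f^{(2)}(x)}{1-2a}\right)\mu_2(K),$$ $$V^{(1)}_{a,\xi,\beta}(x)=\left\{\frac{\mathbb E[Y^2\mid X=x]}{(2-(\beta-a)\xi)f(x)}-\left(\frac{2\xi}{1+a\xi}-\frac{\xi}{1+a}\right)\frac{r^2(x)}{f(x)}\right\}R(K).$$ 1. If $\beta_n^{-1}h_n\to\infty$ (which is automatic when $a<\beta$) and $\beta_n^{-1}h_n^5\to c$ for some $c\ge0$, then $V^{(1)}_{a,\xi,\beta}(x)\ge 0$ and $$\sqrt{\beta_n^{-1}h_n}\,\bigl(r_n(x)-r(x)\bigr)\ \longrightarrow\ \mathcal N\left(\sqrt c\,B^{(1)}_{a,\xi}(x),\,V^{(1)}_{a,\xi,\beta}(x)\right)\quad\text{in distribution}$$ (for $c=0$ the mean is $0$, also when a denominator in $B^{(1)}_{a,\xi}(x)$ vanishes).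 2. If $\beta_n^{-1}h_n^5\to\infty$, then $h_n^{-2}\bigl(r_n(x)-r(x)\bigr)\to B^{(1)}_{a,\xi}(x)$ in probability. -/

import Mathlib

open MeasureTheory ProbabilityTheory Filter Topology

noncomputable section

namespace SemiRec

/-- The Galambos--Seneta class `GS(γ)`: sequences `(v_n)_{n ≥ 1}` of positive reals such that
`n (1 - v_{n-1} / v_n) → γ`. The value `v 0` plays no role. -/
def GS (γ : ℝ) (v : ℕ → ℝ) : Prop :=
  (∀ n : ℕ, 1 ≤ n → 0 < v n) ∧
    Tendsto (fun n : ℕ => ((n : ℝ) + 1) * (1 - v n / v (n + 1))) atTop (𝓝 γ)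

/-- `R(K) = ∫ K²`. -/
def R (K : ℝ → ℝ) : ℝ := ∫ z, K z ^ 2

/-- `μ_j(K) = ∫ z^j K(z) dz`. -/
def kernelMoment (j : ℕ) (K : ℝ → ℝ) : ℝ := ∫ z, z ^ j * K z

/-- `s ↦ ∫ t^q g(s,t) dt`. -/
def mom (g : ℝ → ℝ → ℝ) (q : ℕ) (s : ℝ) : ℝ := ∫ t, t ^ q * g s t

/-- The density `f` of `X`, where `g` is the joint density of `(X, Y)`. -/
def dens (g : ℝ → ℝ → ℝ) (s : ℝ) : ℝ := mom g 0 s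

/-- The function `a(s) = E[Y | X = s] f(s) = ∫ t g(s,t) dt`. -/
def afun (g : ℝ → ℝ → ℝ) (s : ℝ) : ℝ := mom g 1 s

/-- The regression function `r(s) = E[Y | X = s] = a(s) / f(s)`. -/
def regr (g : ℝ → ℝ → ℝ) (s : ℝ) : ℝ := afun g s / dens g s

/-- `E[Y² | X = s]`. -/
def condSecondMoment (g : ℝ → ℝ → ℝ) (s : ℝ) : ℝ := mom g 2 s / dens g s

/-- Assumption (A1) on the kernel. -/
structure A1 (K : ℝ → ℝ) : Prop where
  cont : Continuous K
  bounded : ∃ C : ℝ, ∀ z, |K z| ≤ C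
  integrable : Integrable K
  integral_eq_one : ∫ z, K z = 1
  integrable_sq_mul : Integrable (fun z => z ^ 2 * K z)
  integral_mul_eq_zero : ∫ z, z * K z = 0

/-- Assumption (A2) on the stepsize `(β_n)` and the bandwidth `(h_n)`. In (iii) the sequence
`n β_n` has a limit in `(min {2a, (β - a)/2}, ∞]`. -/
structure A2 (β a : ℝ) (βs h : ℕ → ℝ) : Prop where
  step : GS (-β) βs
  lt_β : 1 / 2 < β
  β_le : β ≤ 1
  bandwidth : GS (-a) h
  a_pos : 0 < a
  a_lt : a < 1
  limit : (∃ L : ℝ, min (2 * a) ((β - a) / 2) < L ∧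
      Tendsto (fun n : ℕ => (n : ℝ) * βs n) atTop (𝓝 L)) ∨
    Tendsto (fun n : ℕ => (n : ℝ) * βs n) atTop atTop

/-- Assumption (A3) on the joint density `g`, at the point `x`. -/
structure A3 (g : ℝ → ℝ → ℝ) (x : ℝ) : Prop where
  smooth : ∀ t, ContDiff ℝ 2 (fun s => g s t)
  integrable_mom : ∀ q : ℕ, q ≤ 2 → ∀ s, Integrable (fun t => t ^ q * g s t)
  bounded_mom : ∀ q : ℕ, q ≤ 2 → ∃ C : ℝ, ∀ s, |mom g q s| ≤ C
  cont_mom : ∀ q : ℕ, q ≤ 2 → ContinuousAt (mom g q) x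
  integrable_absMom : ∀ q : ℝ, 2 ≤ q → q ≤ 3 → ∀ s, Integrable (fun t => |t| ^ q * g s t)
  bounded_absMom : ∀ q : ℝ, 2 ≤ q → q ≤ 3 → ∃ C : ℝ, ∀ s, ∫ t, |t| ^ q * g s t ≤ C
  integrable_deriv : ∀ q : ℕ, q ≤ 1 →
    Integrable (fun t => |t| ^ q * |deriv (fun s => g s t) x|)
  integrable_deriv2 : ∀ q : ℕ, q ≤ 1 → ∀ s,
    Integrable (fun t => t ^ q * iteratedDeriv 2 (fun s' => g s' t) s)
  bounded_deriv2 : ∀ q : ℕ, q ≤ 1 → ∃ C : ℝ, ∀ s,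
    |∫ t, t ^ q * iteratedDeriv 2 (fun s' => g s' t) s| ≤ C
  cont_deriv2 : ∀ q : ℕ, q ≤ 1 →
    ContinuousAt (fun s => ∫ t, t ^ q * iteratedDeriv 2 (fun s' => g s' t) s) x

/-- `F` has a second derivative at the point `x`. -/
def TwiceDifferentiableAt (F : ℝ → ℝ) (x : ℝ) : Prop :=
  (∀ᶠ s in 𝓝 x, DifferentiableAt ℝ F s) ∧ DifferentiableAt ℝ (deriv F) x

/-- `(X_1, Y_1), (X_2, Y_2), …` are independent random pairs, each with joint density `g`
(the index `0` is not used). -/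
structure IsSample {Ω : Type*} [MeasurableSpace Ω] (P : Measure Ω) (X Y : ℕ → Ω → ℝ)
    (g : ℝ → ℝ → ℝ) : Prop where
  meas_X : ∀ n, 1 ≤ n → Measurable (X n)
  meas_Y : ∀ n, 1 ≤ n → Measurable (Y n)
  indep : iIndepFun (fun (n : ℕ) (ω : Ω) => (X (n + 1) ω, Y (n + 1) ω)) P
  meas_g : Measurable (fun p : ℝ × ℝ => g p.1 p.2)
  nonneg_g : ∀ s t, 0 ≤ g s t
  law : ∀ n, 1 ≤ n → P.map (fun ω => (X n ω, Y n ω)) =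
    (volume : Measure (ℝ × ℝ)).withDensity (fun p => ENNReal.ofReal (g p.1 p.2))

section Estimators

variable {Ω : Type*} (K : ℝ → ℝ) (h : ℕ → ℝ) (x : ℝ)

/-- The recursive estimator `a_n(x)` with stepsize `(β_n)` and `a_0(x) = 0`. -/
def aEst (βs : ℕ → ℝ) (X Y : ℕ → Ω → ℝ) : ℕ → Ω → ℝ
  | 0, _ => 0
  | n + 1, ω => (1 - βs (n + 1)) * aEst βs X Y n ω +
      βs (n + 1) * ((h (n + 1))⁻¹ * Y (n + 1) ω * K ((h (n + 1))⁻¹ * (x - X (n + 1) ω)))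

/-- The recursive estimator `f_n(x)` with stepsize `(γ_n)` and `f_0(x) = 0`. -/
def fEst (γs : ℕ → ℝ) (X : ℕ → Ω → ℝ) : ℕ → Ω → ℝ
  | 0, _ => 0
  | n + 1, ω => (1 - γs (n + 1)) * fEst γs X n ω +
      γs (n + 1) * ((h (n + 1))⁻¹ * K ((h (n + 1))⁻¹ * (x - X (n + 1) ω)))

open Classical in
/-- The semi-recursive estimator `r_n(x)`. -/
def rEst (βs γs : ℕ → ℝ) (X Y : ℕ → Ω → ℝ) (n : ℕ) (ω : Ω) : ℝ :=
  if fEst K h x γs X n ω ≠ 0 then aEst K h x βs X Y n ω / fEst K h x γs X n ω else 0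

end Estimators

/-- The bias constant `B_{a,ξ}(x)`. -/
def biasConst (K : ℝ → ℝ) (g : ℝ → ℝ → ℝ) (a ξ x : ℝ) : ℝ :=
  1 / (2 * dens g x) *
    (iteratedDeriv 2 (afun g) x / (1 - 2 * a * ξ) -
      regr g x * iteratedDeriv 2 (dens g) x / (1 - 2 * a)) * kernelMoment 2 K

/-- The variance constant `V_{a,ξ,β}(x)`. -/
def varConst (K : ℝ → ℝ) (g : ℝ → ℝ → ℝ) (a ξ β x : ℝ) : ℝ :=
  (condSecondMoment g x / ((2 - (β - a) * ξ) * dens g x) -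
    (2 * ξ / (1 + a * ξ) - ξ / (1 + a)) * (regr g x ^ 2 / dens g x)) * R K

end SemiRec

end

/-
Multiplied by `f_n(x)`, the error `r_n(x) - r(x)` becomes `a_n(x) - r(x) f_n(x)`, which is a sum of
independent terms: both estimators are weighted sums of kernel terms, with weights that come from
the step sizes. Its mean, its variance and the sum of the third absolute moments of its terms all
satisfy affine recursions `z_n = (1 - c_n) z_{n-1} + e_n`. If the normalisation `u` is regularly
varying, `u ∈ GS(κ)`, then `u_{n-1} / u_n = 1 - κ / n + o(1 / n)`, so that `z_n / u_n` contracts at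
the rate `c_n + κ / n`; with `c_n` asymptotically a multiple of the step size, the limit of
`z_n / u_n` is read off, and this is the source of the factors `1 - 2 a ξ` and `2 - (β - a) ξ`.

Normalised by `β_n / h_n`, the variance converges and the third moments are negligible, whence
Lyapunov's theorem gives the limit law; the mean contributes through the bias, of relative size
`h_n² √(h_n / β_n) → √c`. Since `f_n(x) → f(x)` in probability, Slutsky's theorem passes from
`a_n(x) - r(x) f_n(x)` to the error. The second regime is the same argument with the normalisation
`h_n²`, for which the limiting variance is `0`.
-/

noncomputable section

namespace SemiRec

/-! ### Affine recursions -/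

theorem tendsto_zero_of_le_one_sub_mul {u c : ℕ → ℝ} (hu : ∀ n, 0 ≤ u n)
    (hrec : ∀ᶠ n in atTop, u (n + 1) ≤ (1 - c n) * u n)
    (hc : Tendsto (fun n ↦ ∑ k ∈ Finset.range n, c k) atTop atTop) :
    Tendsto u atTop (𝓝 0) := by
  set S : ℕ → ℝ := fun n ↦ ∑ k ∈ Finset.range n, c k with hS
  obtain ⟨N, hN⟩ := eventually_atTop.1 hrec
  have hstep : ∀ n ≥ N, u (n + 1) * Real.exp (S (n + 1)) ≤ u n * Real.exp (S n) := fun n hn ↦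
    calc u (n + 1) * Real.exp (S (n + 1))
        ≤ Real.exp (-c n) * u n * Real.exp (S (n + 1)) := by
          gcongr
          exact (hN n hn).trans (mul_le_mul_of_nonneg_right (Real.one_sub_le_exp_neg _) (hu n))
      _ = u n * Real.exp (S n) := by
          simp only [hS, Finset.sum_range_succ, Real.exp_add, Real.exp_neg]
          field_simp
  have hbound : ∀ n ≥ N, u n ≤ u N * Real.exp (S N) * Real.exp (-S n) := fun n hn ↦ by
    rw [Real.exp_neg, ← div_eq_mul_inv, le_div_iff₀ (Real.exp_pos _)]
    induction n, hn using Nat.le_induction with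
    | base => exact le_rfl
    | succ n hn ih => exact (hstep n hn).trans ih
  have hlim : Tendsto (fun n ↦ u N * Real.exp (S N) * Real.exp (-S n)) atTop (𝓝 0) := by
    simpa using (Real.tendsto_exp_neg_atTop_nhds_zero.comp hc).const_mul (u N * Real.exp (S N))
  exact squeeze_zero' (Eventually.of_forall hu) (eventually_atTop.2 ⟨N, hbound⟩) hlim

theorem tendsto_zero_of_le_one_sub_mul_add {u c η : ℕ → ℝ} (hu : ∀ n, 0 ≤ u n)
    (hc1 : ∀ᶠ n in atTop, c n ≤ 1) (hc0 : ∀ n, 0 ≤ c n)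
    (hrec : ∀ᶠ n in atTop, u (n + 1) ≤ (1 - c n) * u n + c n * η n)
    (hc : Tendsto (fun n ↦ ∑ k ∈ Finset.range n, c k) atTop atTop)
    (hη : Tendsto η atTop (𝓝 0)) : Tendsto u atTop (𝓝 0) := by
  refine tendsto_order.2 ⟨fun b hb ↦ Eventually.of_forall fun n ↦ hb.trans_le (hu n),
    fun ε hε ↦ ?_⟩
  -- The excess of `u` over `ε / 2` satisfies the homogeneous recursion as soon as `η ≤ ε / 2`.
  have hexcess : Tendsto (fun n ↦ max (u n - ε / 2) 0) atTop (𝓝 0) := by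
    refine tendsto_zero_of_le_one_sub_mul (fun n ↦ le_max_right _ _) ?_ hc
    filter_upwards [hrec, hc1, hη.eventually_le_const (half_pos hε)] with n hn hcn hηn
    have hstep : u (n + 1) - ε / 2 ≤ (1 - c n) * (u n - ε / 2) := by
      linarith [mul_le_mul_of_nonneg_left hηn (hc0 n)]
    exact max_le (hstep.trans (mul_le_mul_of_nonneg_left (le_max_left _ _) (by linarith)))
      (mul_nonneg (by linarith) (le_max_right _ _))
  filter_upwards [hexcess.eventually_lt_const (half_pos hε)] with n hn
  linarith [le_max_left (u n - ε / 2) 0]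

theorem tendsto_of_affine_rec {t b p w : ℕ → ℝ} {p₀ w₀ : ℝ}
    (hrec : ∀ᶠ n in atTop, t (n + 1) = (1 - b n * p n) * t n + b n * w n)
    (hb : ∀ n, 0 ≤ b n) (hb0 : Tendsto b atTop (𝓝 0))
    (hsum : Tendsto (fun n ↦ ∑ k ∈ Finset.range n, b k) atTop atTop)
    (hp : Tendsto p atTop (𝓝 p₀)) (hp₀ : 0 < p₀) (hw : Tendsto w atTop (𝓝 w₀)) :
    Tendsto t atTop (𝓝 (w₀ / p₀)) := by
  set l := w₀ / p₀ with hl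
  have hbp : Tendsto (fun n ↦ b n * p n) atTop (𝓝 0) := by simpa using hb0.mul hp
  have hη : Tendsto (fun n ↦ 2 / p₀ * |w n - p n * l|) atTop (𝓝 0) := by
    have := ((hw.sub (hp.mul_const l)).abs).const_mul (2 / p₀)
    rwa [hl, mul_div_cancel₀ _ hp₀.ne', sub_self, abs_zero, mul_zero] at this
  have hp_half : ∀ᶠ n in atTop, p₀ / 2 ≤ p n := hp.eventually_const_le (half_lt_self hp₀)
  have hbp1 : ∀ᶠ n in atTop, b n * p n ≤ 1 := hbp.eventually_le_const one_pos
  have hdist : Tendsto (fun n ↦ |t n - l|) atTop (𝓝 0) := by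
    refine tendsto_zero_of_le_one_sub_mul_add (c := fun n ↦ p₀ / 2 * b n) (fun n ↦ abs_nonneg _)
      ?_ (fun n ↦ mul_nonneg (half_pos hp₀).le (hb n)) ?_ ?_ hη
    · filter_upwards [hp_half, hbp1] with n hpn hbn
      linarith [mul_le_mul_of_nonneg_left hpn (hb n)]
    · filter_upwards [hrec, hp_half, hbp1] with n hn hpn hbn
      calc |t (n + 1) - l| = |(1 - b n * p n) * (t n - l) + b n * (w n - p n * l)| := by
            rw [hn]; ring_nf
        _ ≤ (1 - b n * p n) * |t n - l| + b n * |w n - p n * l| := by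
            refine (abs_add_le _ _).trans_eq ?_
            rw [abs_mul, abs_mul, abs_of_nonneg (hb n), abs_of_nonneg (sub_nonneg.2 hbn)]
        _ ≤ (1 - p₀ / 2 * b n) * |t n - l| + b n * |w n - p n * l| := by
            rw [mul_comm (p₀ / 2)]
            gcongr
            exact hb n
        _ = (1 - p₀ / 2 * b n) * |t n - l| +
            p₀ / 2 * b n * (2 / p₀ * |w n - p n * l|) := by field_simp
    · simpa only [← Finset.mul_sum] using hsum.const_mul_atTop (half_pos hp₀)
  exact tendsto_iff_dist_tendsto_zero.2 hdist

/-! ### The Galambos--Seneta class -/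

theorem tendsto_zero_of_succ_mul {y : ℕ → ℝ} {γ : ℝ}
    (h : Tendsto (fun n : ℕ ↦ ((n : ℝ) + 1) * y n) atTop (𝓝 γ)) : Tendsto y atTop (𝓝 0) := by
  have := h.mul tendsto_one_div_add_atTop_nhds_zero_nat
  rw [mul_zero] at this
  refine this.congr fun n ↦ ?_
  field_simp

namespace GS

variable {γ γ' : ℝ} {v v' : ℕ → ℝ}

theorem tendsto_div_succ (h : GS γ v) : Tendsto (fun n ↦ v n / v (n + 1)) atTop (𝓝 1) := by
  simpa using (tendsto_zero_of_succ_mul h.2).const_sub 1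

theorem const {c : ℝ} (hc : 0 < c) : GS 0 (fun _ ↦ c) :=
  ⟨fun _ _ ↦ hc, by simp [hc.ne']⟩

theorem mul (h : GS γ v) (h' : GS γ' v') : GS (γ + γ') (fun n ↦ v n * v' n) := by
  refine ⟨fun n hn ↦ mul_pos (h.1 n hn) (h'.1 n hn), ?_⟩
  have hlim := h.2.add (h.tendsto_div_succ.mul h'.2)
  rw [one_mul] at hlim
  refine hlim.congr fun n ↦ ?_
  rw [← div_mul_div_comm]
  ring

theorem inv (h : GS γ v) : GS (-γ) (fun n ↦ (v n)⁻¹) := by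
  refine ⟨fun n hn ↦ inv_pos.2 (h.1 n hn), ?_⟩
  have hlim := (h.2.div h.tendsto_div_succ one_ne_zero).neg
  rw [div_one] at hlim
  refine hlim.congr' ?_
  filter_upwards [eventually_ge_atTop 1] with n hn
  have := h.1 n hn
  have := h.1 (n + 1) (by lia)
  simp only [Pi.div_apply]
  field_simp
  ring

theorem pow (h : GS γ v) : ∀ m : ℕ, GS (m * γ) (fun n ↦ v n ^ m)
  | 0 => by simpa using const one_pos
  | m + 1 => by
    simpa only [pow_succ, Nat.cast_add, Nat.cast_one, add_mul, one_mul] using (h.pow m).mul h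

theorem sqrt (h : GS γ v) : GS (γ / 2) (fun n ↦ √(v n)) := by
  refine ⟨fun n hn ↦ Real.sqrt_pos.2 (h.1 n hn), ?_⟩
  have hden : Tendsto (fun n ↦ 1 + √(v n / v (n + 1))) atTop (𝓝 2) := by
    simpa [one_add_one_eq_two] using h.tendsto_div_succ.sqrt.const_add 1
  refine (h.2.div hden two_ne_zero).congr' ?_
  filter_upwards [eventually_ge_atTop 1] with n hn
  rw [← Real.sqrt_div (h.1 n hn).le, Pi.div_apply, div_eq_iff (by positivity), mul_assoc]
  have hsq := Real.mul_self_sqrt (div_nonneg (h.1 n hn).le (h.1 (n + 1) (by lia)).le)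
  linear_combination ((n : ℝ) + 1) * hsq

end GS

theorem gs_inv_natCast : GS (-1) (fun n : ℕ ↦ (n : ℝ)⁻¹) := by
  refine ⟨fun n hn ↦ by positivity, ?_⟩
  have hlim : Tendsto (fun n : ℕ ↦ -(1 + (n : ℝ)⁻¹)) atTop (𝓝 (-1)) := by
    simpa using (tendsto_inv_atTop_nhds_zero_nat.const_add (1 : ℝ)).neg
  refine hlim.congr' ?_
  filter_upwards [eventually_ge_atTop 1] with n hn
  have : (n : ℝ) ≠ 0 := by positivity
  push_cast
  field_simp
  ring

/-! ### Stepsizes -/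

/-- A stepsize of order at least `1 / n`: a positive null sequence with `(n s_n)⁻¹ → ξ`. Both
averaging recursions of the estimator, `(γ_n)` with `ξ = 1` and `(β_n)`, are driven by such a
sequence. The value `s 0` plays no role. -/
structure StepSize (ξ : ℝ) (s : ℕ → ℝ) : Prop where
  pos : ∀ n : ℕ, 1 ≤ n → 0 < s n
  tendsto_zero : Tendsto s atTop (𝓝 0)
  tendsto_inv : Tendsto (fun n : ℕ ↦ ((n : ℝ) * s n)⁻¹) atTop (𝓝 ξ)

theorem stepSize_inv_natCast : StepSize 1 (fun n : ℕ ↦ (n : ℝ)⁻¹) where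
  pos n hn := by positivity
  tendsto_zero := tendsto_inv_atTop_nhds_zero_nat
  tendsto_inv := by
    refine tendsto_const_nhds.congr' ?_
    filter_upwards [eventually_ge_atTop 1] with n hn
    have : (n : ℝ) ≠ 0 := by positivity
    field_simp

namespace StepSize

variable {ξ : ℝ} {s : ℕ → ℝ}

theorem nonneg (hs : StepSize ξ s) : 0 ≤ ξ := by
  refine ge_of_tendsto hs.tendsto_inv ?_
  filter_upwards [eventually_ge_atTop 1] with n hn
  have := hs.pos n hn
  positivity

theorem tendsto_div_self (hs : StepSize ξ s) : Tendsto (fun n ↦ s n / s n) atTop (𝓝 1) := by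
  refine tendsto_const_nhds.congr' ?_
  filter_upwards [eventually_ge_atTop 1] with n hn using (div_self (hs.pos n hn).ne').symm

theorem tendsto_sum (hs : StepSize ξ s) :
    Tendsto (fun n ↦ ∑ k ∈ Finset.range n, s (k + 1)) atTop atTop := by
  rw [← not_summable_iff_tendsto_nat_atTop_of_nonneg fun n ↦ (hs.pos (n + 1) (by lia)).le]
  intro hsum
  refine Real.not_summable_natCast_inv (Summable.of_norm_bounded_eventually_nat
    (((summable_nat_add_iff 1).1 hsum).mul_left (ξ + 1)) ?_)
  filter_upwards [hs.tendsto_inv.eventually_lt_const (lt_add_one ξ), eventually_ge_atTop 1]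
    with n hn hn1
  rw [mul_inv, ← div_eq_mul_inv, div_lt_iff₀ (hs.pos n hn1)] at hn
  rw [Real.norm_of_nonneg (by positivity)]
  exact hn.le

theorem tendsto_div_succ {γ : ℝ} {y : ℕ → ℝ} (hs : StepSize ξ s)
    (hy : Tendsto (fun n : ℕ ↦ ((n : ℝ) + 1) * y n) atTop (𝓝 γ)) :
    Tendsto (fun n : ℕ ↦ y n / s (n + 1)) atTop (𝓝 (γ * ξ)) := by
  refine (hy.mul ((tendsto_add_atTop_iff_nat 1).2 hs.tendsto_inv)).congr fun n ↦ ?_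
  have := hs.pos (n + 1) (by lia)
  push_cast
  field_simp

/- Dividing by `u` turns the recursion into one for `z n / u n` whose contraction rate is
`m n + (1 - u n / u (n + 1)) / s (n + 1)` up to a null term; the Galambos--Seneta exponent of `u`
enters the limit through the second summand. -/
theorem tendsto_div_of_rec {κ m₀ w₀ : ℝ} {u z m q : ℕ → ℝ} (hs : StepSize ξ s) (hu : GS κ u)
    (hrec : ∀ᶠ n in atTop, z (n + 1) = (1 - s (n + 1) * m n) * z n + s (n + 1) * q n)
    (hm : Tendsto m atTop (𝓝 m₀)) (hq : Tendsto (fun n ↦ q n / u (n + 1)) atTop (𝓝 w₀))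
    (hpos : 0 < m₀ + κ * ξ) :
    Tendsto (fun n ↦ z n / u n) atTop (𝓝 (w₀ / (m₀ + κ * ξ))) := by
  set y : ℕ → ℝ := fun n ↦ 1 - u n / u (n + 1) with hy
  have hrate : Tendsto (fun n ↦ m n + y n / s (n + 1) - m n * y n) atTop (𝓝 (m₀ + κ * ξ)) := by
    simpa using (hm.add (hs.tendsto_div_succ hu.2)).sub (hm.mul (tendsto_zero_of_succ_mul hu.2))
  refine tendsto_of_affine_rec (b := fun n ↦ s (n + 1)) ?_
    (fun n ↦ (hs.pos (n + 1) (by lia)).le)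
    ((tendsto_add_atTop_iff_nat 1).2 hs.tendsto_zero) hs.tendsto_sum hrate hpos hq
  filter_upwards [hrec, eventually_ge_atTop 1] with n hn hn1
  have := hu.1 n hn1
  have := hu.1 (n + 1) (by lia)
  have := hs.pos (n + 1) (by lia)
  rw [hn]
  simp only [hy]
  field_simp
  ring

end StepSize

namespace GS

variable {γ : ℝ} {v : ℕ → ℝ}

/- `v n = 1 / (v n)⁻¹`, and the constant sequence `1` solves a recursion without forcing. -/
theorem tendsto_zero_of_neg (h : GS γ v) (hγ : γ < 0) : Tendsto v atTop (𝓝 0) := by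
  simpa using stepSize_inv_natCast.tendsto_div_of_rec (z := fun _ ↦ 1) (m := fun _ ↦ 0)
    (q := fun _ ↦ 0) h.inv (Eventually.of_forall fun n ↦ by simp) tendsto_const_nhds (w₀ := 0)
    (by simp) (by linarith)

theorem nonpos_of_tendsto (h : GS γ v) {c : ℝ} (hc : Tendsto v atTop (𝓝 c)) : γ ≤ 0 := by
  by_contra! hγ
  have hzero := hc.mul (h.inv.tendsto_zero_of_neg (by linarith))
  rw [mul_zero] at hzero
  have hone : Tendsto (fun n ↦ v n * (v n)⁻¹) atTop (𝓝 1) := by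
    refine tendsto_const_nhds.congr' ?_
    filter_upwards [eventually_ge_atTop 1] with n hn
    rw [mul_inv_cancel₀ (h.1 n hn).ne']
  exact zero_ne_one (tendsto_nhds_unique hzero hone)

theorem nonneg_of_tendsto_atTop (h : GS γ v) (hc : Tendsto v atTop atTop) : 0 ≤ γ := by
  linarith [h.inv.nonpos_of_tendsto (tendsto_inv_atTop_zero.comp hc)]

theorem eq_zero_of_tendsto (h : GS γ v) {c : ℝ} (hc : Tendsto v atTop (𝓝 c)) (hc0 : c ≠ 0) :
    γ = 0 := by
  linarith [h.nonpos_of_tendsto hc, h.inv.nonpos_of_tendsto (hc.inv₀ hc0)]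

end GS

/-! ### Lyapunov's central limit theorem -/

theorem norm_prod_sub_prod_le_sum {ι A : Type*} [NormedCommRing A] [NormOneClass A]
    (s : Finset ι) {a b : ι → A}
    (ha : ∀ i ∈ s, ‖a i‖ ≤ 1) (hb : ∀ i ∈ s, ‖b i‖ ≤ 1) :
    ‖∏ i ∈ s, a i - ∏ i ∈ s, b i‖ ≤ ∑ i ∈ s, ‖a i - b i‖ := by
  classical
  induction s using Finset.induction_on with
  | empty => simp
  | insert i s hi ih =>
    rw [Finset.prod_insert hi, Finset.prod_insert hi, Finset.sum_insert hi]
    have hprod : ‖∏ j ∈ s, a j‖ ≤ 1 := (Finset.norm_prod_le _ _).trans <|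
      Finset.prod_le_one (fun _ _ ↦ norm_nonneg _) fun j hj ↦ ha j (Finset.mem_insert_of_mem hj)
    have hbi : ‖b i‖ ≤ 1 := hb i (Finset.mem_insert_self i s)
    have ih := ih (fun j hj ↦ ha j (Finset.mem_insert_of_mem hj))
      (fun j hj ↦ hb j (Finset.mem_insert_of_mem hj))
    calc ‖a i * ∏ j ∈ s, a j - b i * ∏ j ∈ s, b j‖
        = ‖(a i - b i) * ∏ j ∈ s, a j + b i * (∏ j ∈ s, a j - ∏ j ∈ s, b j)‖ := by ring_nf
      _ ≤ ‖a i - b i‖ * ‖∏ j ∈ s, a j‖ + ‖b i‖ * ‖∏ j ∈ s, a j - ∏ j ∈ s, b j‖ :=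
        (norm_add_le _ _).trans (add_le_add (norm_mul_le _ _) (norm_mul_le _ _))
      _ ≤ ‖a i - b i‖ * 1 + 1 * ∑ j ∈ s, ‖a j - b j‖ := by gcongr
      _ = ‖a i - b i‖ + ∑ j ∈ s, ‖a j - b j‖ := by ring

theorem norm_exp_mul_I_sub_taylor_le (y : ℝ) :
    ‖Complex.exp (y * Complex.I) - (1 + y * Complex.I - y ^ 2 / 2)‖ ≤ 4 * |y| ^ 3 := by
  have hnorm : ‖(y : ℂ) * Complex.I‖ = |y| := by simp
  rcases le_total |y| 1 with hy | hy
  · have htaylor : (1 : ℂ) + y * Complex.I - y ^ 2 / 2 =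
        ∑ m ∈ Finset.range 3, ((y : ℂ) * Complex.I) ^ m / (m.factorial : ℂ) := by
      simp only [Finset.sum_range_succ, Finset.sum_range_zero, Nat.factorial, mul_pow,
        Complex.I_sq]
      push_cast
      ring
    rw [htaylor]
    refine (Complex.exp_bound (hnorm.trans_le hy) (by norm_num : 0 < 3)).trans ?_
    rw [hnorm, mul_comm]
    gcongr
    norm_num [Nat.factorial]
  · have hpoly : ‖(1 : ℂ) + y * Complex.I - y ^ 2 / 2‖ ≤ 1 + |y| + |y| ^ 2 / 2 := by
      refine (norm_sub_le _ _).trans (add_le_add ((norm_add_le _ _).trans ?_) ?_)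
      · rw [hnorm, norm_one]
      · simp
    have hcube : |y| ≤ |y| ^ 3 := le_self_pow₀ hy (by norm_num)
    have hsq : |y| ^ 2 ≤ |y| ^ 3 := pow_le_pow_right₀ hy (by norm_num)
    calc _ ≤ 1 + (1 + |y| + |y| ^ 2 / 2) :=
          (norm_sub_le _ _).trans (add_le_add (Complex.norm_exp_ofReal_mul_I y).le hpoly)
      _ ≤ 4 * |y| ^ 3 := by linarith

theorem abs_exp_neg_sq_sub_le {y : ℝ} (hy : 0 ≤ y) :
    |Real.exp (-y ^ 2) - (1 - y ^ 2)| ≤ y ^ 3 := by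
  rcases le_total y 1 with h | h
  · calc |Real.exp (-y ^ 2) - (1 - y ^ 2)| = |Real.exp (-y ^ 2) - 1 - -y ^ 2| := by ring_nf
      _ ≤ (-y ^ 2) ^ 2 := Real.abs_exp_sub_one_sub_id_le (by
          rw [abs_neg, abs_of_nonneg (by positivity)]
          exact pow_le_one₀ hy h)
      _ = y ^ 4 := by ring
      _ ≤ y ^ 3 := pow_le_pow_of_le_one hy h (by norm_num)
  · have hlower : 0 ≤ Real.exp (-y ^ 2) - (1 - y ^ 2) := by
      linarith [Real.add_one_le_exp (-y ^ 2)]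
    have hupper : Real.exp (-y ^ 2) ≤ 1 := Real.exp_le_one_iff.2 (by nlinarith)
    rw [abs_of_nonneg hlower]
    linarith [pow_le_pow_right₀ h (by norm_num : 2 ≤ 3)]

section Lyapunov

variable {Ω : Type*} [MeasurableSpace Ω] {P : Measure Ω} [IsProbabilityMeasure P]

theorem sqrt_integral_sq_pow_three_le {Z : Ω → ℝ} (hZ : MemLp Z 3 P) :
    √(∫ ω, Z ω ^ 2 ∂P) ^ 3 ≤ ∫ ω, |Z ω| ^ 3 ∂P := by
  have hpow : ∀ u : ℝ, 0 ≤ u → √u ^ 3 = u ^ (3 / 2 : ℝ) := fun u hu ↦ by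
    rw [Real.rpow_div_two_eq_sqrt _ hu]
    norm_cast
  have hcube : ∀ ω, (Z ω ^ 2) ^ (3 / 2 : ℝ) = |Z ω| ^ 3 := fun ω ↦ by
    rw [← hpow _ (sq_nonneg _), Real.sqrt_sq_eq_abs]
  have hsq : Integrable (fun ω ↦ Z ω ^ 2) P := (hZ.mono_exponent (by norm_num)).integrable_sq
  have hint : Integrable (fun ω ↦ |Z ω| ^ 3) P := hZ.integrable_norm_pow (p := 3) (by norm_num)
  rw [hpow _ (integral_nonneg fun _ ↦ sq_nonneg _)]
  simpa only [hcube] using (convexOn_rpow (by norm_num : (1 : ℝ) ≤ 3 / 2)).map_integral_le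
    (continuousOn_id.rpow_const fun _ _ ↦ Or.inr (by norm_num)) isClosed_Ici
    (Eventually.of_forall fun ω ↦ sq_nonneg (Z ω)) hsq (by simpa only [Function.comp_def, hcube])

theorem norm_charFun_sub_one_sub_le {Z : Ω → ℝ} (hZ : MemLp Z 3 P) (h0 : ∫ ω, Z ω ∂P = 0)
    (t : ℝ) :
    ‖charFun (P.map Z) t - ((1 - t ^ 2 * (∫ ω, Z ω ^ 2 ∂P) / 2 : ℝ) : ℂ)‖ ≤
      4 * |t| ^ 3 * ∫ ω, |Z ω| ^ 3 ∂P := by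
  have hm : AEMeasurable Z P := hZ.aestronglyMeasurable.aemeasurable
  have hint : Integrable (fun ω ↦ ((t * Z ω : ℝ) : ℂ) * Complex.I) P :=
    ((hZ.integrable (by norm_num)).const_mul t).ofReal.mul_const _
  have hint_lin : Integrable (fun ω ↦ 1 + ((t * Z ω : ℝ) : ℂ) * Complex.I) P :=
    (integrable_const 1).add hint
  have hint_sq : Integrable (fun ω ↦ ((t * Z ω : ℝ) : ℂ) ^ 2 / 2) P := by
    simpa using (((hZ.mono_exponent (q := 3) (p := 2) (by norm_num)).const_mul t).integrable_sq
      |>.div_const 2).ofReal (𝕜 := ℂ)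
  have hint_taylor : Integrable
      (fun ω ↦ 1 + ((t * Z ω : ℝ) : ℂ) * Complex.I - ((t * Z ω : ℝ) : ℂ) ^ 2 / 2) P :=
    hint_lin.sub hint_sq
  have hint_exp : Integrable (fun ω ↦ Complex.exp ((t * Z ω : ℝ) * Complex.I)) P := by
    refine Integrable.of_bound (C := 1) (AEMeasurable.aestronglyMeasurable (by fun_prop))
      (Eventually.of_forall fun ω ↦ ?_)
    rw [Complex.norm_exp_ofReal_mul_I]
  have hcharFun : charFun (P.map Z) t = ∫ ω, Complex.exp ((t * Z ω : ℝ) * Complex.I) ∂P := by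
    rw [charFun_apply_real, integral_map hm (by fun_prop)]
    simp only [Complex.ofReal_mul]
  have htaylor : ((1 - t ^ 2 * (∫ ω, Z ω ^ 2 ∂P) / 2 : ℝ) : ℂ) =
      ∫ ω, (1 + (t * Z ω : ℝ) * Complex.I - ((t * Z ω : ℝ) : ℂ) ^ 2 / 2) ∂P := by
    rw [integral_sub hint_lin hint_sq,
      integral_add (integrable_const _) hint, integral_mul_const, integral_complex_ofReal,
      integral_const_mul, h0, integral_div]
    simp only [← Complex.ofReal_pow, integral_complex_ofReal, mul_pow, integral_const_mul]
    simp
  rw [hcharFun, htaylor, ← integral_sub hint_exp hint_taylor, ← integral_const_mul]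
  refine norm_integral_le_of_norm_le ((hZ.integrable_norm_pow (p := 3) (by norm_num)).const_mul _)
    (Eventually.of_forall fun ω ↦ (norm_exp_mul_I_sub_taylor_le (t * Z ω)).trans_eq ?_)
  rw [abs_mul, mul_pow, mul_assoc, ← Real.norm_eq_abs (Z ω)]

theorem norm_charFun_sub_exp_le {Z : Ω → ℝ} (hZ : MemLp Z 3 P) (h0 : ∫ ω, Z ω ∂P = 0) (t : ℝ) :
    ‖charFun (P.map Z) t - (Real.exp (-(t ^ 2 * (∫ ω, Z ω ^ 2 ∂P) / 2)) : ℂ)‖ ≤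
      5 * |t| ^ 3 * ∫ ω, |Z ω| ^ 3 ∂P := by
  set S := ∫ ω, Z ω ^ 2 ∂P
  have hS0 : 0 ≤ S := integral_nonneg fun _ ↦ sq_nonneg _
  have hexp : |Real.exp (-(t ^ 2 * S / 2)) - (1 - t ^ 2 * S / 2)| ≤
      |t| ^ 3 * ∫ ω, |Z ω| ^ 3 ∂P := by
    have hy : (|t| * √S / √2) ^ 2 = t ^ 2 * S / 2 := by
      rw [div_pow, mul_pow, sq_abs, Real.sq_sqrt hS0, Real.sq_sqrt (by norm_num)]
    rw [← hy]
    calc _ ≤ (|t| * √S / √2) ^ 3 := abs_exp_neg_sq_sub_le (by positivity)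
      _ ≤ (|t| * √S) ^ 3 := by
          gcongr
          exact div_le_self (by positivity) (Real.one_le_sqrt.2 (by norm_num))
      _ = |t| ^ 3 * √S ^ 3 := mul_pow _ _ _
      _ ≤ |t| ^ 3 * ∫ ω, |Z ω| ^ 3 ∂P := by gcongr; exact sqrt_integral_sq_pow_three_le hZ
  calc _ ≤ ‖charFun (P.map Z) t - ((1 - t ^ 2 * S / 2 : ℝ) : ℂ)‖ +
        ‖((1 - t ^ 2 * S / 2 : ℝ) : ℂ) - (Real.exp (-(t ^ 2 * S / 2)) : ℂ)‖ :=
        norm_sub_le_norm_sub_add_norm_sub _ _ _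
    _ ≤ 4 * |t| ^ 3 * (∫ ω, |Z ω| ^ 3 ∂P) + |t| ^ 3 * ∫ ω, |Z ω| ^ 3 ∂P := by
        refine add_le_add (norm_charFun_sub_one_sub_le hZ h0 t) ?_
        rwa [← Complex.ofReal_sub, Complex.norm_real, Real.norm_eq_abs, abs_sub_comm]
    _ = 5 * |t| ^ 3 * ∫ ω, |Z ω| ^ 3 ∂P := by ring

theorem tendsto_prod_charFun_of_lyapunov {Z : ℕ → ℕ → Ω → ℝ} {V : ℝ}
    (hZ : ∀ n k, MemLp (Z n k) 3 P) (h0 : ∀ n k, ∫ ω, Z n k ω ∂P = 0)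
    (hV : Tendsto (fun n ↦ ∑ k ∈ Finset.range n, ∫ ω, Z n k ω ^ 2 ∂P) atTop (𝓝 V))
    (hL : Tendsto (fun n ↦ ∑ k ∈ Finset.range n, ∫ ω, |Z n k ω| ^ 3 ∂P) atTop (𝓝 0)) (t : ℝ) :
    Tendsto (fun n ↦ ∏ k ∈ Finset.range n, charFun (P.map (Z n k)) t) atTop
      (𝓝 (Real.exp (-(t ^ 2 * V / 2)) : ℂ)) := by
  have hgauss : Tendsto (fun n ↦ ∏ k ∈ Finset.range n,
      (Real.exp (-(t ^ 2 * (∫ ω, Z n k ω ^ 2 ∂P) / 2)) : ℂ)) atTop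
      (𝓝 (Real.exp (-(t ^ 2 * V / 2)) : ℂ)) := by
    simp_rw [← Complex.ofReal_prod, ← Real.exp_sum, Finset.sum_neg_distrib, ← Finset.sum_div,
      ← Finset.mul_sum]
    exact (Complex.continuous_ofReal.tendsto _).comp
      ((Real.continuous_exp.tendsto _).comp ((hV.const_mul (t ^ 2)).div_const 2).neg)
  have hdiff : Tendsto (fun n ↦ ∏ k ∈ Finset.range n, charFun (P.map (Z n k)) t -
      ∏ k ∈ Finset.range n, (Real.exp (-(t ^ 2 * (∫ ω, Z n k ω ^ 2 ∂P) / 2)) : ℂ)) atTop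
      (𝓝 0) := by
    refine squeeze_zero_norm (fun n ↦ ?_) (by simpa using hL.const_mul (5 * |t| ^ 3))
    have (k : ℕ) : IsProbabilityMeasure (P.map (Z n k)) :=
      Measure.isProbabilityMeasure_map (hZ n k).aestronglyMeasurable.aemeasurable
    refine (norm_prod_sub_prod_le_sum _ (fun k _ ↦ norm_charFun_le_one t) fun k _ ↦ ?_).trans ?_
    · rw [Complex.norm_real, Real.norm_of_nonneg (Real.exp_pos _).le, Real.exp_le_one_iff,
        neg_nonpos]
      have : 0 ≤ ∫ ω, Z n k ω ^ 2 ∂P := integral_nonneg fun _ ↦ sq_nonneg _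
      positivity
    · rw [Finset.mul_sum]
      exact Finset.sum_le_sum fun k _ ↦ norm_charFun_sub_exp_le (hZ n k) (h0 n k) t
  simpa using hdiff.add hgauss

theorem tendstoInDistribution_of_lyapunov {Z : ℕ → ℕ → Ω → ℝ} {b : ℕ → ℝ} {b₀ V : ℝ}
    (hind : ∀ n, iIndepFun (Z n) P) (hZ : ∀ n k, MemLp (Z n k) 3 P)
    (h0 : ∀ n k, ∫ ω, Z n k ω ∂P = 0)
    (hV : Tendsto (fun n ↦ ∑ k ∈ Finset.range n, ∫ ω, Z n k ω ^ 2 ∂P) atTop (𝓝 V))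
    (hL : Tendsto (fun n ↦ ∑ k ∈ Finset.range n, ∫ ω, |Z n k ω| ^ 3 ∂P) atTop (𝓝 0))
    (hb : Tendsto b atTop (𝓝 b₀)) :
    TendstoInDistribution (fun n ω ↦ b n + ∑ k ∈ Finset.range n, Z n k ω) atTop (id : ℝ → ℝ)
      (fun _ ↦ P) (gaussianReal b₀ V.toNNReal) := by
  have hV0 : 0 ≤ V := ge_of_tendsto' hV fun n ↦
    Finset.sum_nonneg fun k _ ↦ integral_nonneg fun _ ↦ sq_nonneg _
  have hm : ∀ n k, AEMeasurable (Z n k) P := fun n k ↦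
    (hZ n k).aestronglyMeasurable.aemeasurable
  have hsum : ∀ n, AEMeasurable (fun ω ↦ ∑ k ∈ Finset.range n, Z n k ω) P := fun n ↦
    Finset.aemeasurable_fun_sum _ fun k _ ↦ hm n k
  refine ⟨fun n ↦ (hsum n).const_add _, aemeasurable_id,
    ProbabilityMeasure.tendsto_iff_tendsto_charFun.2 fun t ↦ ?_⟩
  simp only [ProbabilityMeasure.coe_mk, Measure.map_id]
  have hcharFun : ∀ n, charFun (P.map (fun ω ↦ b n + ∑ k ∈ Finset.range n, Z n k ω)) t =
      (∏ k ∈ Finset.range n, charFun (P.map (Z n k)) t) *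
        Complex.exp ((b n * t : ℝ) * Complex.I) := fun n ↦ by
    have hshift := charFun_map_const_add
      (μ := P.map (fun ω ↦ ∑ k ∈ Finset.range n, Z n k ω)) (b n) t
    rw [AEMeasurable.map_map_of_aemeasurable (by fun_prop) (hsum n),
      ((hind n).restrict _).charFun_map_fun_finsetSum_eq_prod (fun _ _ ↦ hm n _)] at hshift
    simpa [Function.comp_def, mul_comm t] using hshift
  have hexp : Tendsto (fun n ↦ Complex.exp ((b n * t : ℝ) * Complex.I)) atTop
      (𝓝 (Complex.exp ((b₀ * t : ℝ) * Complex.I))) :=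
    (Continuous.tendsto (by fun_prop : Continuous fun u : ℝ ↦
      Complex.exp ((u * t : ℝ) * Complex.I)) b₀).comp hb
  simp_rw [hcharFun]
  convert (tendsto_prod_charFun_of_lyapunov hZ h0 hV hL t).mul hexp using 2
  rw [charFun_gaussianReal, Complex.ofReal_exp, ← Complex.exp_add, Real.coe_toNNReal _ hV0]
  push_cast
  ring_nf

end Lyapunov

section TriangularArray

variable {Ω : Type*} [MeasurableSpace Ω] {P : Measure Ω}

theorem integral_abs_sub_cube_le {Z Z' : Ω → ℝ} (hZ : MemLp Z 3 P) (hZ' : MemLp Z' 3 P) :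
    ∫ ω, |Z ω - Z' ω| ^ 3 ∂P ≤ 4 * (∫ ω, |Z ω| ^ 3 ∂P + ∫ ω, |Z' ω| ^ 3 ∂P) := by
  have hint : ∀ {Z : Ω → ℝ}, MemLp Z 3 P → Integrable (fun ω ↦ |Z ω| ^ 3) P := fun h ↦
    h.integrable_norm_pow (p := 3) (by norm_num)
  rw [← integral_add (hint hZ) (hint hZ'), ← integral_const_mul]
  refine integral_mono (hint (hZ.sub hZ')) (((hint hZ).add (hint hZ')).const_mul 4) fun ω ↦ ?_
  calc |Z ω - Z' ω| ^ 3 ≤ (|Z ω| + |Z' ω|) ^ 3 := by gcongr; exact abs_sub _ _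
    _ ≤ 4 * (|Z ω| ^ 3 + |Z' ω| ^ 3) := by
      simpa [show (2 : ℝ) ^ 2 = 4 by norm_num] using
        add_pow_le (abs_nonneg (Z ω)) (abs_nonneg (Z' ω)) 3

theorem nonneg_of_tendsto_sum_variance {E : ℕ → ℕ → Ω → ℝ} {u : ℕ → ℝ} {V : ℝ}
    (hvar : Tendsto (fun n ↦ (∑ k ∈ Finset.range n, Var[E n k; P]) / u n ^ 2) atTop (𝓝 V)) :
    0 ≤ V :=
  ge_of_tendsto' hvar fun _ ↦
    div_nonneg (Finset.sum_nonneg fun _ _ ↦ variance_nonneg _ _) (sq_nonneg _)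

variable [IsProbabilityMeasure P]

theorem integral_abs_sub_integral_cube_le {Z : Ω → ℝ} (hZ : MemLp Z 3 P) :
    ∫ ω, |Z ω - ∫ ω, Z ω ∂P| ^ 3 ∂P ≤ 8 * ∫ ω, |Z ω| ^ 3 ∂P := by
  have hmean : |∫ ω, Z ω ∂P| ≤ √(∫ ω, Z ω ^ 2 ∂P) := by
    refine Real.abs_le_sqrt ?_
    have := variance_nonneg Z P
    rw [variance_eq_sub (hZ.mono_exponent (by norm_num))] at this
    simpa using this
  have hcube : |∫ ω, Z ω ∂P| ^ 3 ≤ ∫ ω, |Z ω| ^ 3 ∂P :=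
    (pow_le_pow_left₀ (abs_nonneg _) hmean 3).trans (sqrt_integral_sq_pow_three_le hZ)
  have := integral_abs_sub_cube_le hZ (memLp_const (∫ ω, Z ω ∂P))
  rw [integral_const, probReal_univ, one_smul] at this
  linarith

theorem tendstoInDistribution_sum_div {E : ℕ → ℕ → Ω → ℝ} {u : ℕ → ℝ} {b V : ℝ}
    (hind : ∀ n, iIndepFun (E n) P) (hE : ∀ n k, MemLp (E n k) 3 P) (hu : ∀ᶠ n in atTop, 0 < u n)
    (hmean : Tendsto (fun n ↦ (∑ k ∈ Finset.range n, ∫ ω, E n k ω ∂P) / u n) atTop (𝓝 b))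
    (hvar : Tendsto (fun n ↦ (∑ k ∈ Finset.range n, Var[E n k; P]) / u n ^ 2) atTop (𝓝 V))
    (hthird : Tendsto (fun n ↦ (∑ k ∈ Finset.range n, ∫ ω, |E n k ω| ^ 3 ∂P) / u n ^ 3) atTop
      (𝓝 0)) :
    TendstoInDistribution (fun n ω ↦ (∑ k ∈ Finset.range n, E n k ω) / u n) atTop (id : ℝ → ℝ)
      (fun _ ↦ P) (gaussianReal b V.toNNReal) := by
  have hint : ∀ n k, Integrable (E n k) P := fun n k ↦ (hE n k).integrable (by norm_num)
  have hclt := tendstoInDistribution_of_lyapunov (V := V)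
    (Z := fun n k ω ↦ (E n k ω - ∫ ω, E n k ω ∂P) / u n)
    (fun n ↦ (hind n).comp (fun k y ↦ (y - ∫ ω, E n k ω ∂P) / u n) fun k ↦ by fun_prop)
    (fun n k ↦ by
      simp only [div_eq_inv_mul]
      exact ((hE n k).sub (memLp_const _)).const_mul (u n)⁻¹)
    (fun n k ↦ by rw [integral_div, integral_sub (hint n k) (integrable_const _)]; simp)
    ?_ ?_ hmean
  · refine hclt.congr (fun n ↦ Eventually.of_forall fun ω ↦ ?_) .rfl
    simp only [← Finset.sum_div, Finset.sum_sub_distrib]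
    ring
  · refine hvar.congr fun n ↦ ?_
    simp_rw [div_pow, integral_div, ← Finset.sum_div]
    congr! 2 with k
    exact variance_eq_integral (hE n k).aestronglyMeasurable.aemeasurable
  · have hlim := hthird.const_mul 8
    rw [mul_zero] at hlim
    refine squeeze_zero' (Eventually.of_forall fun n ↦ Finset.sum_nonneg fun k _ ↦
      integral_nonneg fun _ ↦ by positivity) ?_ hlim
    filter_upwards [hu] with n hn
    simp_rw [abs_div, div_pow, integral_div, ← Finset.sum_div, abs_of_pos hn]
    rw [← mul_div_assoc, Finset.mul_sum]
    gcongr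
    exact integral_abs_sub_integral_cube_le (hE n _)

end TriangularArray

/-! ### Convergence in probability and Slutsky's theorem -/

section Slutsky

variable {Ω : Type*} [MeasurableSpace Ω] {P : Measure Ω} [IsProbabilityMeasure P]

theorem tendstoInMeasure_of_tendsto_variance {Z : ℕ → Ω → ℝ} {c : ℝ} (hZ : ∀ n, MemLp (Z n) 2 P)
    (hmean : Tendsto (fun n ↦ ∫ ω, Z n ω ∂P) atTop (𝓝 c))
    (hvar : Tendsto (fun n ↦ Var[Z n; P]) atTop (𝓝 0)) :
    TendstoInMeasure P Z atTop (fun _ ↦ c) := by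
  rw [tendstoInMeasure_iff_norm]
  intro ε hε
  have hlim : Tendsto (fun n ↦ ENNReal.ofReal (Var[Z n; P] / (ε / 2) ^ 2)) atTop (𝓝 0) := by
    simpa using ENNReal.tendsto_ofReal (hvar.div_const ((ε / 2) ^ 2))
  refine tendsto_of_tendsto_of_tendsto_of_le_of_le' tendsto_const_nhds hlim
    (Eventually.of_forall fun _ ↦ zero_le) ?_
  filter_upwards [Metric.tendsto_nhds.1 hmean (ε / 2) (half_pos hε)] with n hn
  refine (measure_mono fun ω (hω : ε ≤ ‖Z n ω - c‖) ↦ ?_).trans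
    (meas_ge_le_variance_div_sq (hZ n) (half_pos hε))
  rw [Real.dist_eq] at hn
  have := norm_sub_le_norm_sub_add_norm_sub (Z n ω) (∫ ω, Z n ω ∂P) c
  simp only [Real.norm_eq_abs] at hω this
  exact (by linarith : ε / 2 ≤ |Z n ω - ∫ ω, Z n ω ∂P|)

theorem tendstoInMeasure_of_tendstoInDistribution_dirac {W : ℕ → Ω → ℝ} {c : ℝ}
    (h : TendstoInDistribution W atTop (id : ℝ → ℝ) (fun _ ↦ P) (Measure.dirac c)) :
    TendstoInMeasure P W atTop (fun _ ↦ c) := by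
  rw [tendstoInMeasure_iff_norm]
  intro ε hε
  have hclosed : IsClosed {y : ℝ | ε ≤ ‖y - c‖} := isClosed_le (by fun_prop) (by fun_prop)
  have hlimsup := ProbabilityMeasure.limsup_measure_closed_le_of_tendsto h.tendsto hclosed
  have hzero : Measure.dirac c {y : ℝ | ε ≤ ‖y - c‖} = 0 := by
    rw [Measure.dirac_apply' _ hclosed.measurableSet]
    simp [hε]
  simp only [ProbabilityMeasure.coe_mk, Measure.map_id, hzero, nonpos_iff_eq_zero] at hlimsup
  refine (tendsto_of_le_liminf_of_limsup_le zero_le hlimsup.le).congr fun n ↦ ?_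
  rw [Measure.map_apply_of_aemeasurable (h.forall_aemeasurable n) hclosed.measurableSet]
  rfl

omit [IsProbabilityMeasure P] in
theorem tendstoInMeasure_comp {D : ℕ → Ω → ℝ} {F : ℝ} {φ : ℝ → ℝ} (hφ : ContinuousAt φ F)
    (hD : TendstoInMeasure P D atTop (fun _ ↦ F)) :
    TendstoInMeasure P (fun n ω ↦ φ (D n ω)) atTop (fun _ ↦ φ F) := by
  rw [tendstoInMeasure_iff_dist] at hD ⊢
  intro ε hε
  obtain ⟨δ, hδ, hφδ⟩ := Metric.continuousAt_iff.1 hφ ε hε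
  refine tendsto_of_tendsto_of_tendsto_of_le_of_le tendsto_const_nhds (hD δ hδ)
    (fun _ ↦ zero_le) fun n ↦ measure_mono fun ω (hω : ε ≤ dist _ _) ↦ ?_
  exact not_lt.1 fun hlt ↦ hω.not_gt (hφδ hlt)

theorem tendstoInDistribution_mul_div {S D W : ℕ → Ω → ℝ} {F : ℝ} {ν : Measure ℝ}
    [IsProbabilityMeasure ν] (hF : F ≠ 0)
    (hS : TendstoInDistribution S atTop (id : ℝ → ℝ) (fun _ ↦ P) ν)
    (hD : TendstoInMeasure P D atTop (fun _ ↦ F)) (hDm : ∀ n, AEMeasurable (D n) P)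
    (hWm : ∀ n, AEMeasurable (W n) P)
    (hW : ∀ n ω, D n ω ≠ 0 → W n ω = S n ω * (F / D n ω)) :
    TendstoInDistribution W atTop (id : ℝ → ℝ) (fun _ ↦ P) ν := by
  have hratio : TendstoInMeasure P (fun n ω ↦ F / D n ω) atTop (fun _ ↦ 1) := by
    have := tendstoInMeasure_comp (φ := fun y ↦ F / y)
      (continuousAt_const.div continuousAt_id hF) hD
    rwa [div_self hF] at this
  have hprod := hS.continuous_comp_prodMk_of_tendstoInMeasure_const
    (g := fun p : ℝ × ℝ ↦ p.1 * p.2) (by fun_prop) hratio fun n ↦ (hDm n).const_div F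
  simp only [mul_one] at hprod
  refine tendstoInDistribution_of_tendstoInMeasure_sub _ _ hprod ?_ hWm
  rw [tendstoInMeasure_iff_norm] at hD ⊢
  intro ε hε
  refine tendsto_of_tendsto_of_tendsto_of_le_of_le tendsto_const_nhds (hD |F| (abs_pos.2 hF))
    (fun _ ↦ zero_le) fun n ↦ measure_mono fun ω hω ↦ ?_
  have hzero : D n ω = 0 := by
    by_contra hne
    have hω' : ε ≤ ‖W n ω - S n ω * (F / D n ω) - 0‖ := hω
    rw [hW n ω hne, sub_self, sub_zero, norm_zero] at hω'
    exact hε.not_ge hω'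
  change |F| ≤ ‖D n ω - F‖
  rw [hzero, zero_sub, norm_neg, Real.norm_eq_abs]

end Slutsky

/-! ### Smoothing by a kernel -/

theorem integrable_mul_of_integral_norm_le {α β : Type*} [MeasurableSpace α] [MeasurableSpace β]
    {μ : Measure α} {ν : Measure β} [SFinite ν] {φ : α → ℝ} {m : α × β → ℝ} {C : ℝ}
    (hφ : Integrable φ μ) (hm : Measurable m) (hmi : ∀ s, Integrable (fun t ↦ m (s, t)) ν)
    (hC : ∀ s, ∫ t, ‖m (s, t)‖ ∂ν ≤ C) :
    Integrable (fun p : α × β ↦ φ p.1 * m p) (μ.prod ν) := by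
  have hmeas : AEStronglyMeasurable (fun p : α × β ↦ φ p.1 * m p) (μ.prod ν) :=
    hφ.aestronglyMeasurable.comp_fst.mul hm.aestronglyMeasurable
  refine (integrable_prod_iff hmeas).2 ⟨Eventually.of_forall fun s ↦ (hmi s).const_mul (φ s), ?_⟩
  refine (hφ.norm.mul_const C).mono' hmeas.norm.integral_prod_right' (Eventually.of_forall ?_)
  intro s
  rw [Real.norm_of_nonneg (integral_nonneg fun _ ↦ norm_nonneg _)]
  simp_rw [norm_mul]
  rw [integral_const_mul]
  exact mul_le_mul_of_nonneg_left (hC s) (norm_nonneg _)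

theorem integral_comp_inv_mul_sub_mul (φ m : ℝ → ℝ) (x : ℝ) {b : ℝ} (hb : 0 < b) :
    ∫ s, φ (b⁻¹ * (x - s)) * m s = b * ∫ z, φ z * m (x - b * z) := by
  have hscale := Measure.integral_comp_mul_left (fun u ↦ φ (b⁻¹ * u) * m (x - u)) b
  rw [abs_of_pos (inv_pos.2 hb), smul_eq_mul] at hscale
  simp only [inv_mul_cancel_left₀ hb.ne'] at hscale
  rw [hscale, mul_inv_cancel_left₀ hb.ne', ← integral_sub_left_eq_self _ volume x]
  simp only [sub_sub_cancel]

/-- The total masses and third absolute moments of the sections `g s` of a joint density are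
jointly bounded by `C`; this controls `∫ |τ t| g s t dt` for every weight `|τ t| ≤ 1 + |t|³`. -/
structure ThirdMomentBound (g : ℝ → ℝ → ℝ) (C : ℝ) : Prop where
  integrable : ∀ s, Integrable fun t ↦ (1 + |t| ^ 3) * g s t
  integral_le : ∀ s, ∫ t, (1 + |t| ^ 3) * g s t ≤ C

theorem A3.exists_thirdMomentBound {g : ℝ → ℝ → ℝ} {x : ℝ} (hg : A3 g x) :
    ∃ C, ThirdMomentBound g C := by
  obtain ⟨C₀, hC₀⟩ := hg.bounded_mom 0 (by lia)
  obtain ⟨C₃, hC₃⟩ := hg.bounded_absMom 3 (by norm_num) le_rfl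
  have hint₃ := hg.integrable_absMom 3 (by norm_num) le_rfl
  have hsplit : ∀ s t, (1 + |t| ^ 3) * g s t = t ^ 0 * g s t + |t| ^ (3 : ℝ) * g s t :=
    fun s t ↦ by rw [← Nat.cast_ofNat (R := ℝ), Real.rpow_natCast]; ring
  refine ⟨C₀ + C₃, fun s ↦ ?_, fun s ↦ ?_⟩
  · simp_rw [hsplit]
    exact (hg.integrable_mom 0 (by lia) s).add (hint₃ s)
  · simp_rw [hsplit]
    rw [integral_add (hg.integrable_mom 0 (by lia) s) (hint₃ s)]
    exact add_le_add ((le_abs_self _).trans (hC₀ s)) (hC₃ s)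

theorem abs_pow_le_one_add_abs_cube {q : ℕ} (hq : q ≤ 3) (t : ℝ) : |t ^ q| ≤ 1 + |t| ^ 3 := by
  rw [abs_pow]
  rcases le_total |t| 1 with ht | ht
  · linarith [pow_le_one₀ (n := q) (abs_nonneg t) ht, pow_nonneg (abs_nonneg t) 3]
  · linarith [pow_le_pow_right₀ ht hq]

section JointDensity

variable {g : ℝ → ℝ → ℝ} {C : ℝ} {τ : ℝ → ℝ}

theorem ThirdMomentBound.norm_mul_le (hg₀ : ∀ s t, 0 ≤ g s t)
    (hle : ∀ t, |τ t| ≤ 1 + |t| ^ 3) (s t : ℝ) : ‖τ t * g s t‖ ≤ (1 + |t| ^ 3) * g s t := by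
  rw [norm_mul, Real.norm_of_nonneg (hg₀ s t)]
  exact mul_le_mul_of_nonneg_right (hle t) (hg₀ s t)

theorem ThirdMomentBound.integrable_mul (hM : ThirdMomentBound g C)
    (hg : Measurable fun p : ℝ × ℝ ↦ g p.1 p.2) (hg₀ : ∀ s t, 0 ≤ g s t) (hτ : Measurable τ)
    (hle : ∀ t, |τ t| ≤ 1 + |t| ^ 3) (s : ℝ) : Integrable fun t ↦ τ t * g s t :=
  (hM.integrable s).mono' (hτ.mul (hg.comp measurable_prodMk_left)).aestronglyMeasurable
    (Eventually.of_forall (norm_mul_le hg₀ hle s))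

theorem ThirdMomentBound.integral_norm_mul_le (hM : ThirdMomentBound g C)
    (hg₀ : ∀ s t, 0 ≤ g s t) (hle : ∀ t, |τ t| ≤ 1 + |t| ^ 3) (s : ℝ) :
    ∫ t, ‖τ t * g s t‖ ≤ C :=
  (integral_mono_of_nonneg (Eventually.of_forall fun _ ↦ norm_nonneg _) (hM.integrable s)
    (Eventually.of_forall (norm_mul_le hg₀ hle s))).trans (hM.integral_le s)

theorem ThirdMomentBound.abs_mom_le (hM : ThirdMomentBound g C) (hg₀ : ∀ s t, 0 ≤ g s t) {q : ℕ}
    (hq : q ≤ 3) (s : ℝ) : |mom g q s| ≤ C :=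
  (abs_integral_le_integral_abs).trans
    (hM.integral_norm_mul_le hg₀ (abs_pow_le_one_add_abs_cube hq) s)

theorem measurable_mom (hg : Measurable fun p : ℝ × ℝ ↦ g p.1 p.2) (q : ℕ) :
    Measurable (mom g q) :=
  (((measurable_snd.pow_const q).mul hg).stronglyMeasurable.integral_prod_right
    (ν := (volume : Measure ℝ))).measurable

variable {Ω : Type*} [MeasurableSpace Ω] {P : Measure Ω} {X Y : ℕ → Ω → ℝ} {φ : ℝ → ℝ}

theorem IsSample.integrable_and_integral_mul_kernel (hXY : IsSample P X Y g)
    (hM : ThirdMomentBound g C) (hφ : Measurable φ) (hφi : Integrable φ) (hτ : Measurable τ)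
    (hle : ∀ t, |τ t| ≤ 1 + |t| ^ 3) (x : ℝ) {b : ℝ} (hb : 0 < b) {n : ℕ} (hn : 1 ≤ n) :
    Integrable (fun ω ↦ τ (Y n ω) * φ (b⁻¹ * (x - X n ω))) P ∧
      ∫ ω, τ (Y n ω) * φ (b⁻¹ * (x - X n ω)) ∂P =
        b * ∫ z, φ z * ∫ t, τ t * g (x - b * z) t := by
  set G : ℝ × ℝ → ℝ := fun p ↦ τ p.2 * φ (b⁻¹ * (x - p.1)) with hG
  have hGm : Measurable G := by fun_prop
  have hXYm : Measurable fun ω ↦ (X n ω, Y n ω) := (hXY.meas_X n hn).prodMk (hXY.meas_Y n hn)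
  have hgm := hXY.meas_g
  have hdens : ∀ p : ℝ × ℝ, (ENNReal.ofReal (g p.1 p.2)).toReal • G p =
      φ (b⁻¹ * (x - p.1)) * (τ p.2 * g p.1 p.2) := fun p ↦ by
    rw [ENNReal.toReal_ofReal (hXY.nonneg_g _ _), hG, smul_eq_mul]
    ring
  have hint : Integrable (fun p : ℝ × ℝ ↦ φ (b⁻¹ * (x - p.1)) * (τ p.2 * g p.1 p.2))
      (volume.prod volume) :=
    integrable_mul_of_integral_norm_le ((hφi.comp_mul_left' (inv_ne_zero hb.ne')).comp_sub_left x)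
      (by fun_prop) (hM.integrable_mul hgm hXY.nonneg_g hτ hle)
      (hM.integral_norm_mul_le hXY.nonneg_g hle)
  have hGi : Integrable G (P.map fun ω ↦ (X n ω, Y n ω)) := by
    rw [hXY.law n hn, integrable_withDensity_iff_integrable_smul' hgm.ennreal_ofReal
      (Eventually.of_forall fun _ ↦ ENNReal.ofReal_lt_top)]
    simp_rw [hdens]
    exact hint
  refine ⟨hGi.comp_measurable hXYm, ?_⟩
  calc ∫ ω, G (X n ω, Y n ω) ∂P
      = ∫ p, G p ∂(P.map fun ω ↦ (X n ω, Y n ω)) :=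
        (integral_map hXYm.aemeasurable hGm.aestronglyMeasurable).symm
    _ = ∫ p : ℝ × ℝ, φ (b⁻¹ * (x - p.1)) * (τ p.2 * g p.1 p.2) := by
        rw [hXY.law n hn, integral_withDensity_eq_integral_toReal_smul hgm.ennreal_ofReal
          (Eventually.of_forall fun _ ↦ ENNReal.ofReal_lt_top)]
        simp_rw [hdens]
    _ = ∫ s, φ (b⁻¹ * (x - s)) * ∫ t, τ t * g s t := by
        rw [Measure.volume_eq_prod, integral_prod _ hint]
        simp_rw [integral_const_mul]
    _ = b * ∫ z, φ z * ∫ t, τ t * g (x - b * z) t := integral_comp_inv_mul_sub_mul _ _ x hb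

end JointDensity

theorem tendsto_integral_kernel {φ m : ℝ → ℝ} {C x : ℝ} {b : ℕ → ℝ} (hφ : Integrable φ)
    (hm : Measurable m) (hC : ∀ s, |m s| ≤ C) (hc : ContinuousAt m x)
    (hb : Tendsto b atTop (𝓝 0)) :
    Tendsto (fun n ↦ ∫ z, φ z * m (x - b n * z)) atTop (𝓝 (m x * ∫ z, φ z)) := by
  rw [← integral_const_mul]
  refine tendsto_integral_of_dominated_convergence (fun z ↦ ‖φ z‖ * C)
    (fun n ↦ hφ.aestronglyMeasurable.mul (hm.comp (by fun_prop)).aestronglyMeasurable)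
    (hφ.norm.mul_const C) (fun n ↦ Eventually.of_forall fun z ↦ ?_)
    (Eventually.of_forall fun z ↦ ?_)
  · rw [norm_mul]
    exact mul_le_mul_of_nonneg_left (hC _) (norm_nonneg _)
  · rw [mul_comm (m x)]
    exact (hc.tendsto.comp (by simpa using (hb.mul_const z).const_sub x)).const_mul _

section Taylor

variable {F : ℝ → ℝ} {x : ℝ}

theorem TwiceDifferentiableAt.continuousAt (hF : TwiceDifferentiableAt F x) : ContinuousAt F x :=
  hF.1.self_of_nhds.continuousAt

theorem TwiceDifferentiableAt.isLittleO_deriv (hF : TwiceDifferentiableAt F x) :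
    (fun u ↦ deriv F (x + u) - deriv F x - u * iteratedDeriv 2 F x) =o[𝓝 0] fun u : ℝ ↦ u := by
  have h := hasDerivAt_iff_isLittleO_nhds_zero.1 hF.2.hasDerivAt
  rwa [← iteratedDeriv_one, ← iteratedDeriv_succ, iteratedDeriv_one] at h

theorem TwiceDifferentiableAt.isLittleO (hF : TwiceDifferentiableAt F x) :
    (fun u ↦ F (x + u) - F x - deriv F x * u - iteratedDeriv 2 F x / 2 * u ^ 2)
      =o[𝓝 0] fun u : ℝ ↦ u ^ 2 := by
  set D := iteratedDeriv 2 F x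
  set ρ : ℝ → ℝ := fun u ↦ F (x + u) - F x - deriv F x * u - D / 2 * u ^ 2 with hρ
  refine Asymptotics.isLittleO_iff.2 fun ε hε ↦ ?_
  have hx : Tendsto (fun u : ℝ ↦ x + u) (𝓝 0) (𝓝 x) :=
    (continuous_const_add x).tendsto' 0 x (add_zero x)
  obtain ⟨δ, hδ, hball⟩ := Metric.eventually_nhds_iff_ball.1
    ((Asymptotics.isLittleO_iff.1 hF.isLittleO_deriv hε).and (hx.eventually hF.1))
  refine Metric.eventually_nhds_iff_ball.2 ⟨δ, hδ, fun u hu ↦ ?_⟩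
  have hsub : Metric.closedBall (0 : ℝ) ‖u‖ ⊆ Metric.ball 0 δ :=
    Metric.closedBall_subset_ball (mem_ball_zero_iff.1 hu)
  have hderiv : ∀ v ∈ Metric.closedBall (0 : ℝ) ‖u‖,
      HasDerivWithinAt ρ (deriv F (x + v) - deriv F x - v * D) (Metric.closedBall 0 ‖u‖) v := by
    intro v hv
    have hFv := ((hball v (hsub hv)).2.hasDerivAt).comp_const_add x v
    refine ((((hFv.sub_const (F x)).sub ((hasDerivAt_id v).const_mul (deriv F x))).sub
      (((hasDerivAt_id v).pow 2).const_mul (D / 2))).congr_deriv ?_).hasDerivWithinAt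
    simp
    ring
  have hbound : ∀ v ∈ Metric.closedBall (0 : ℝ) ‖u‖,
      ‖deriv F (x + v) - deriv F x - v * D‖ ≤ ε * ‖u‖ := fun v hv ↦
    (hball v (hsub hv)).1.trans
      (mul_le_mul_of_nonneg_left (mem_closedBall_zero_iff.1 hv) hε.le)
  have hmvt := (convex_closedBall (0 : ℝ) ‖u‖).norm_image_sub_le_of_norm_hasDerivWithin_le
    hderiv hbound (Metric.mem_closedBall_self (norm_nonneg u)) (mem_closedBall_zero_iff.2 le_rfl)
  have hρ0 : ρ 0 = 0 := by simp [hρ]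
  rw [hρ0, sub_zero, sub_zero] at hmvt
  refine hmvt.trans_eq ?_
  rw [norm_pow]
  ring

theorem exists_abs_le_mul_sq_of_isLittleO {ρ : ℝ → ℝ} {D A B : ℝ}
    (hρ : (fun u ↦ ρ u - D * u ^ 2) =o[𝓝 0] fun u : ℝ ↦ u ^ 2)
    (hle : ∀ u, |ρ u| ≤ A + B * |u|) : ∃ M, ∀ u, |ρ u| ≤ M * u ^ 2 := by
  obtain ⟨δ, hδ, hball⟩ := Metric.eventually_nhds_iff_ball.1
    (Asymptotics.isLittleO_iff.1 hρ one_pos)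
  refine ⟨(1 + |D|) + (|A| / δ ^ 2 + |B| / δ), fun u ↦ ?_⟩
  rw [add_mul]
  rcases lt_or_ge |u| δ with hu | hu
  · have hnear : |ρ u - D * u ^ 2| ≤ u ^ 2 := by
      simpa [Real.norm_eq_abs] using hball u (mem_ball_zero_iff.2 hu)
    have htri : |ρ u| ≤ u ^ 2 + |D| * u ^ 2 := by
      have := abs_add_le (ρ u - D * u ^ 2) (D * u ^ 2)
      rw [sub_add_cancel, abs_mul, abs_sq] at this
      linarith
    have : 0 ≤ (|A| / δ ^ 2 + |B| / δ) * u ^ 2 := by positivity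
    linarith
  · have hA : A ≤ |A| / δ ^ 2 * u ^ 2 := by
      rw [div_mul_eq_mul_div, le_div_iff₀ (by positivity), ← sq_abs u]
      gcongr
      exact le_abs_self A
    have hB : B * |u| ≤ |B| / δ * u ^ 2 := by
      rw [div_mul_eq_mul_div, le_div_iff₀ hδ, ← sq_abs u, sq, ← mul_assoc]
      gcongr
      exact le_abs_self B
    have : 0 ≤ (1 + |D|) * u ^ 2 := by positivity
    linarith [hle u]

theorem TwiceDifferentiableAt.exists_abs_remainder_le (hF : TwiceDifferentiableAt F x) {C : ℝ}
    (hC : ∀ s, |F s| ≤ C) :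
    ∃ M, ∀ u, |F (x + u) - F x - deriv F x * u| ≤ M * u ^ 2 := by
  refine exists_abs_le_mul_sq_of_isLittleO (A := 2 * C) (B := |deriv F x|) hF.isLittleO
    fun u ↦ ?_
  have h₁ := abs_sub (F (x + u) - F x) (deriv F x * u)
  have h₂ := abs_sub (F (x + u)) (F x)
  rw [abs_mul] at h₁
  linarith [hC x, hC (x + u)]

end Taylor

/-- A bounded measurable kernel of order two: total mass one, vanishing first moment, and finite
second absolute moment. -/
structure SecondOrderKernel (K : ℝ → ℝ) : Prop where
  measurable : Measurable K
  bounded : ∃ C : ℝ, ∀ z, |K z| ≤ C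
  integrable : Integrable K
  integral_eq_one : ∫ z, K z = 1
  integrable_sq_mul : Integrable fun z ↦ z ^ 2 * K z
  integral_mul_eq_zero : ∫ z, z * K z = 0

theorem A1.secondOrderKernel {K : ℝ → ℝ} (hK : A1 K) : SecondOrderKernel K where
  measurable := hK.cont.measurable
  bounded := hK.bounded
  integrable := hK.integrable
  integral_eq_one := hK.integral_eq_one
  integrable_sq_mul := hK.integrable_sq_mul
  integral_mul_eq_zero := hK.integral_mul_eq_zero

namespace SecondOrderKernel

variable {K F : ℝ → ℝ} {C x b : ℝ}

theorem integrable_pow (hK : SecondOrderKernel K) {p : ℕ} (hp : p ≠ 0) :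
    Integrable fun z ↦ K z ^ p := by
  obtain ⟨M, hM⟩ := hK.bounded
  refine (hK.integrable.norm.const_mul (M ^ (p - 1))).mono'
    (hK.measurable.pow_const p).aestronglyMeasurable (Eventually.of_forall fun z ↦ ?_)
  rw [norm_pow, ← pow_sub_one_mul hp]
  gcongr
  exact hM z

theorem integrable_mul (hK : SecondOrderKernel K) : Integrable fun z ↦ z * K z := by
  refine (hK.integrable.norm.add hK.integrable_sq_mul.norm).mono'
    (measurable_id.mul hK.measurable).aestronglyMeasurable (Eventually.of_forall fun z ↦ ?_)
  simp only [Pi.add_apply, norm_mul, norm_pow]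
  have hz : ‖z‖ ≤ 1 + ‖z‖ ^ 2 := by nlinarith [sq_nonneg (‖z‖ - 1)]
  linarith [mul_le_mul_of_nonneg_right hz (norm_nonneg (K z))]

/- The vanishing first moment of `K` makes room for the linear Taylor term of `F` at `x`. -/
theorem integral_mul_sub_eq (hK : SecondOrderKernel K) (hF : Measurable F)
    (hC : ∀ s, |F s| ≤ C) (d : ℝ) :
    (∫ z, K z * F (x - b * z)) - F x =
      ∫ z, K z * (F (x + -(b * z)) - F x - d * -(b * z)) := by
  have hKF : Integrable fun z ↦ K z * F (x - b * z) :=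
    hK.integrable.mul_bdd (hF.comp (by fun_prop)).aestronglyMeasurable
      (Eventually.of_forall fun z ↦ hC _)
  have hlin : Integrable fun z ↦ F x * K z - d * b * (z * K z) :=
    (hK.integrable.const_mul _).sub (hK.integrable_mul.const_mul _)
  calc (∫ z, K z * F (x - b * z)) - F x
      = (∫ z, K z * F (x - b * z)) - ∫ z, (F x * K z - d * b * (z * K z)) := by
        rw [integral_sub (hK.integrable.const_mul _) (hK.integrable_mul.const_mul _),
          integral_const_mul, integral_const_mul, hK.integral_eq_one, hK.integral_mul_eq_zero]
        ring
    _ = _ := by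
        rw [← integral_sub hKF hlin]
        congr 1 with z
        rw [← sub_eq_add_neg]
        ring

theorem tendsto_bias (hK : SecondOrderKernel K) (hF : Measurable F) (hC : ∀ s, |F s| ≤ C)
    (hF₂ : TwiceDifferentiableAt F x) {b : ℕ → ℝ} (hpos : ∀ n, 0 < b n)
    (hb : Tendsto b atTop (𝓝 0)) :
    Tendsto (fun n ↦ ((∫ z, K z * F (x - b n * z)) - F x) / b n ^ 2) atTop
      (𝓝 (iteratedDeriv 2 F x / 2 * kernelMoment 2 K)) := by
  set D := iteratedDeriv 2 F x
  set ρ : ℝ → ℝ := fun u ↦ F (x + u) - F x - deriv F x * u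
  obtain ⟨M, hM⟩ := hF₂.exists_abs_remainder_le hC
  have hKm := hK.measurable
  simp_rw [hK.integral_mul_sub_eq hF hC (deriv F x), ← integral_div, kernelMoment,
    ← integral_const_mul]
  refine tendsto_integral_of_dominated_convergence (fun z ↦ M * ‖z ^ 2 * K z‖)
    (fun n ↦ Measurable.aestronglyMeasurable (by fun_prop)) (hK.integrable_sq_mul.norm.const_mul M)
    (fun n ↦ Eventually.of_forall fun z ↦ ?_) (Eventually.of_forall fun z ↦ ?_)
  · have hpos_n := hpos n
    rw [norm_div, norm_mul, Real.norm_of_nonneg (sq_nonneg (b n)), div_le_iff₀ (by positivity)]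
    calc ‖K z‖ * |ρ (-(b n * z))| ≤ ‖K z‖ * (M * (-(b n * z)) ^ 2) := by gcongr; exact hM _
      _ = M * ‖z ^ 2 * K z‖ * b n ^ 2 := by
        rw [norm_mul, Real.norm_of_nonneg (sq_nonneg z)]
        ring
  · have harg : Tendsto (fun n ↦ -(b n * z)) atTop (𝓝 0) := by
      simpa using (hb.mul_const z).neg
    have hsq : (fun n ↦ (-(b n * z)) ^ 2) =O[atTop] fun n ↦ b n ^ 2 :=
      .of_bound (z ^ 2) (Eventually.of_forall fun n ↦ by
        rw [Real.norm_of_nonneg (sq_nonneg _), Real.norm_of_nonneg (sq_nonneg _)]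
        exact le_of_eq (by ring))
    have hlim := ((((hF₂.isLittleO.comp_tendsto harg).trans_isBigO hsq).tendsto_div_nhds_zero
      ).add_const (D / 2 * z ^ 2)).const_mul (K z)
    rw [zero_add, mul_left_comm, mul_comm (K z)] at hlim
    refine hlim.congr fun n ↦ ?_
    have := (hpos n).ne'
    simp only [Function.comp_apply, D]
    field_simp
    ring

end SecondOrderKernel

/-! ### The summands of the two estimators -/

/-- The summand `h⁻¹ Y ^ q K((x - X) / h)` of the numerator (`q = 1`) and of the denominator
(`q = 0`). The `k`-th summand belongs to the pair `(X_{k+1}, Y_{k+1})`. -/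
def kernelTerm {Ω : Type*} (K : ℝ → ℝ) (h : ℕ → ℝ) (x : ℝ) (X Y : ℕ → Ω → ℝ) (q k : ℕ)
    (ω : Ω) : ℝ :=
  (h (k + 1))⁻¹ * (Y (k + 1) ω ^ q * K ((h (k + 1))⁻¹ * (x - X (k + 1) ω)))

/-- The moment asymptotics of the summands `T k` of a kernel estimator with bandwidth `h`: the
mean is `A + A₂ h² + o(h²)`, the variance is equivalent to `v / h`, and the third absolute moment
is `O(h⁻²)`. -/
structure KernelMoments {Ω : Type*} [MeasurableSpace Ω] (P : Measure Ω) (h : ℕ → ℝ)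
    (T : ℕ → Ω → ℝ) (A A₂ v : ℝ) : Prop where
  memLp : ∀ k, MemLp (T k) 3 P
  mean : Tendsto (fun k ↦ (∫ ω, T k ω ∂P - A) / h (k + 1) ^ 2) atTop (𝓝 A₂)
  variance : Tendsto (fun k ↦ h (k + 1) * Var[T k; P]) atTop (𝓝 v)
  third : ∃ C, ∀ k, h (k + 1) ^ 2 * ∫ ω, |T k ω| ^ 3 ∂P ≤ C

theorem memLp_three_of_integrable_abs_cube {Ω : Type*} [MeasurableSpace Ω] {P : Measure Ω}
    {Z : Ω → ℝ} (hZ : AEStronglyMeasurable Z P) (h : Integrable (fun ω ↦ |Z ω| ^ 3) P) :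
    MemLp Z 3 P := by
  refine (integrable_norm_rpow_iff hZ (by norm_num) (by norm_num)).1 ?_
  simpa using h

namespace IsSample

variable {Ω : Type*} [MeasurableSpace Ω] {P : Measure Ω} {X Y : ℕ → Ω → ℝ} {g : ℝ → ℝ → ℝ}
  {K : ℝ → ℝ} {h : ℕ → ℝ} {x C : ℝ} {q q' : ℕ}

theorem measurable_kernelTerm (hXY : IsSample P X Y g) (hK : Measurable K) (q k : ℕ) :
    Measurable (kernelTerm K h x X Y q k) := by
  have := hXY.meas_X (k + 1) (by lia)
  have := hXY.meas_Y (k + 1) (by lia)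
  unfold kernelTerm
  fun_prop

theorem iIndepFun_kernelTerm (hXY : IsSample P X Y g) (hK : Measurable K) (q q' : ℕ) :
    iIndepFun (fun k ω ↦ (kernelTerm K h x X Y q k ω, kernelTerm K h x X Y q' k ω)) P :=
  hXY.indep.comp (fun k p ↦ ((h (k + 1))⁻¹ * (p.2 ^ q * K ((h (k + 1))⁻¹ * (x - p.1))),
    (h (k + 1))⁻¹ * (p.2 ^ q' * K ((h (k + 1))⁻¹ * (x - p.1))))) fun k ↦ by fun_prop

theorem integral_kernelTerm (hXY : IsSample P X Y g) (hK : SecondOrderKernel K)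
    (hM : ThirdMomentBound g C) (hpos : ∀ n, 1 ≤ n → 0 < h n) (hq : q ≤ 3) (k : ℕ) :
    ∫ ω, kernelTerm K h x X Y q k ω ∂P = ∫ z, K z * mom g q (x - h (k + 1) * z) := by
  have hk := hpos (k + 1) (by lia)
  simp only [kernelTerm]
  rw [integral_const_mul, (hXY.integrable_and_integral_mul_kernel hM hK.measurable hK.integrable
    (measurable_id'.pow_const q) (abs_pow_le_one_add_abs_cube hq) x hk (by lia)).2,
    inv_mul_cancel_left₀ hk.ne']
  rfl

theorem integral_kernelTerm_mul (hXY : IsSample P X Y g) (hK : SecondOrderKernel K)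
    (hM : ThirdMomentBound g C) (hpos : ∀ n, 1 ≤ n → 0 < h n) (hq : q + q' ≤ 3) (k : ℕ) :
    h (k + 1) * ∫ ω, kernelTerm K h x X Y q k ω * kernelTerm K h x X Y q' k ω ∂P =
      ∫ z, K z ^ 2 * mom g (q + q') (x - h (k + 1) * z) := by
  have hk := hpos (k + 1) (by lia)
  have hprod : ∀ ω, kernelTerm K h x X Y q k ω * kernelTerm K h x X Y q' k ω =
      (h (k + 1))⁻¹ ^ 2 *
        (Y (k + 1) ω ^ (q + q') * K ((h (k + 1))⁻¹ * (x - X (k + 1) ω)) ^ 2) := fun ω ↦ by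
    simp only [kernelTerm]
    ring
  simp_rw [hprod]
  rw [integral_const_mul, (hXY.integrable_and_integral_mul_kernel hM (hK.measurable.pow_const 2)
    (hK.integrable_pow two_ne_zero) (measurable_id'.pow_const (q + q'))
    (abs_pow_le_one_add_abs_cube hq) x hk (by lia)).2]
  field_simp
  rfl

theorem kernelTerm_cube (hXY : IsSample P X Y g) (hK : SecondOrderKernel K)
    (hM : ThirdMomentBound g C) (hpos : ∀ n, 1 ≤ n → 0 < h n) (hq : q ≤ 1) (k : ℕ) :
    Integrable (fun ω ↦ |kernelTerm K h x X Y q k ω| ^ 3) P ∧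
      h (k + 1) ^ 2 * ∫ ω, |kernelTerm K h x X Y q k ω| ^ 3 ∂P ≤ (∫ z, |K z ^ 3|) * C := by
  have hk := hpos (k + 1) (by lia)
  have hcube : ∀ ω, |kernelTerm K h x X Y q k ω| ^ 3 = (h (k + 1))⁻¹ ^ 3 *
      (|Y (k + 1) ω ^ (q * 3)| * |K ((h (k + 1))⁻¹ * (x - X (k + 1) ω)) ^ 3|) := fun ω ↦ by
    simp only [kernelTerm, abs_mul, abs_pow, abs_of_pos (inv_pos.2 hk), mul_pow, ← pow_mul]
  have hle : ∀ t : ℝ, |(|t ^ (q * 3)|)| ≤ 1 + |t| ^ 3 := fun t ↦ by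
    rw [abs_abs]
    exact abs_pow_le_one_add_abs_cube (by lia) t
  obtain ⟨hint, heq⟩ := hXY.integrable_and_integral_mul_kernel hM
    (φ := fun z ↦ |K z ^ 3|) (τ := fun t ↦ |t ^ (q * 3)|) (by have := hK.measurable; fun_prop)
    (hK.integrable_pow three_ne_zero).abs (by fun_prop) hle x hk (n := k + 1) (by lia)
  simp_rw [hcube]
  refine ⟨hint.const_mul _, ?_⟩
  calc h (k + 1) ^ 2 * ∫ ω, (h (k + 1))⁻¹ ^ 3 *
        (|Y (k + 1) ω ^ (q * 3)| * |K ((h (k + 1))⁻¹ * (x - X (k + 1) ω)) ^ 3|) ∂P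
      = ∫ z, |K z ^ 3| * ∫ t, |t ^ (q * 3)| * g (x - h (k + 1) * z) t := by
        rw [integral_const_mul, heq]
        field_simp
    _ ≤ ∫ z, |K z ^ 3| * C := by
        refine integral_mono_of_nonneg (Eventually.of_forall fun z ↦ ?_)
          ((hK.integrable_pow three_ne_zero).abs.mul_const C) (Eventually.of_forall fun z ↦ ?_)
        · exact mul_nonneg (abs_nonneg _)
            (integral_nonneg fun t ↦ mul_nonneg (abs_nonneg _) (hXY.nonneg_g _ _))
        · exact mul_le_mul_of_nonneg_left ((le_abs_self _).trans
            (abs_integral_le_integral_abs.trans (hM.integral_norm_mul_le hXY.nonneg_g hle _)))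
            (abs_nonneg _)
    _ = (∫ z, |K z ^ 3|) * C := integral_mul_const _ _

theorem memLp_kernelTerm (hXY : IsSample P X Y g) (hK : SecondOrderKernel K)
    (hM : ThirdMomentBound g C) (hpos : ∀ n, 1 ≤ n → 0 < h n) (hq : q ≤ 1) (k : ℕ) :
    MemLp (kernelTerm K h x X Y q k) 3 P :=
  memLp_three_of_integrable_abs_cube
    (hXY.measurable_kernelTerm hK.measurable q k).aestronglyMeasurable
    (hXY.kernelTerm_cube hK hM hpos hq k).1

theorem tendsto_covariance_kernelTerm [IsProbabilityMeasure P] (hXY : IsSample P X Y g)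
    (hK : SecondOrderKernel K) (hM : ThirdMomentBound g C) (hpos : ∀ n, 1 ≤ n → 0 < h n)
    (hh : Tendsto h atTop (𝓝 0)) (hq : q ≤ 1) (hq' : q' ≤ 1) (hc : ContinuousAt (mom g q) x)
    (hc' : ContinuousAt (mom g q') x) (hcc : ContinuousAt (mom g (q + q')) x) :
    Tendsto (fun k ↦ h (k + 1) * cov[kernelTerm K h x X Y q k, kernelTerm K h x X Y q' k; P])
      atTop (𝓝 (mom g (q + q') x * R K)) := by
  have hh' := (tendsto_add_atTop_iff_nat 1).2 hh
  have hmean : ∀ p ≤ 1, ContinuousAt (mom g p) x →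
      Tendsto (fun k ↦ ∫ ω, kernelTerm K h x X Y p k ω ∂P) atTop (𝓝 (mom g p x)) := by
    intro p hp hcp
    simp_rw [hXY.integral_kernelTerm hK hM hpos (hp.trans (by lia : 1 ≤ 3))]
    simpa [hK.integral_eq_one] using tendsto_integral_kernel hK.integrable
      (measurable_mom hXY.meas_g p) (hM.abs_mom_le hXY.nonneg_g (by lia)) hcp hh'
  have hprod : Tendsto (fun k ↦ h (k + 1) *
      ∫ ω, kernelTerm K h x X Y q k ω * kernelTerm K h x X Y q' k ω ∂P) atTop
      (𝓝 (mom g (q + q') x * R K)) := by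
    simp_rw [hXY.integral_kernelTerm_mul hK hM hpos (by lia : q + q' ≤ 3)]
    exact tendsto_integral_kernel (hK.integrable_pow two_ne_zero) (measurable_mom hXY.meas_g _)
      (hM.abs_mom_le hXY.nonneg_g (by lia)) hcc hh'
  have hlim := hprod.sub (hh'.mul ((hmean q hq hc).mul (hmean q' hq' hc')))
  rw [zero_mul, sub_zero] at hlim
  refine hlim.congr fun k ↦ ?_
  rw [covariance_eq_sub ((hXY.memLp_kernelTerm hK hM hpos hq k).mono_exponent (by norm_num))
    ((hXY.memLp_kernelTerm hK hM hpos hq' k).mono_exponent (by norm_num)), mul_sub]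
  rfl

theorem kernelMoments [IsProbabilityMeasure P] (hXY : IsSample P X Y g)
    (hK : SecondOrderKernel K) (hM : ThirdMomentBound g C) (hpos : ∀ n, 1 ≤ n → 0 < h n)
    (hh : Tendsto h atTop (𝓝 0)) (hq : q ≤ 1) (hF : TwiceDifferentiableAt (mom g q) x)
    (hc : ContinuousAt (mom g (q + q)) x) :
    KernelMoments P h (kernelTerm K h x X Y q) (mom g q x)
      (iteratedDeriv 2 (mom g q) x / 2 * kernelMoment 2 K) (mom g (q + q) x * R K) where
  memLp := hXY.memLp_kernelTerm hK hM hpos hq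
  mean := by
    simp_rw [hXY.integral_kernelTerm hK hM hpos (by lia : q ≤ 3)]
    exact hK.tendsto_bias (measurable_mom hXY.meas_g q) (hM.abs_mom_le hXY.nonneg_g (by lia)) hF
      (fun n ↦ hpos (n + 1) (by lia)) ((tendsto_add_atTop_iff_nat 1).2 hh)
  variance := by
    simp_rw [← covariance_self (hXY.measurable_kernelTerm hK.measurable q _).aemeasurable]
    exact hXY.tendsto_covariance_kernelTerm hK hM hpos hh hq hq hF.continuousAt hF.continuousAt hc
  third := ⟨_, fun k ↦ (hXY.kernelTerm_cube hK hM hpos hq k).2⟩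

end IsSample

/-! ### Weights of the stochastic approximation recursions -/

/-- The weight of the `k`-th summand (counted from `0`) after `n` steps of the recursion
`z_{n+1} = (1 - s_{n+1}) z_n + s_{n+1} T_n`, `z_0 = 0`. -/
def weight (s : ℕ → ℝ) : ℕ → ℕ → ℝ
  | 0, _ => 0
  | n + 1, k => if k = n then s (n + 1) else (1 - s (n + 1)) * weight s n k

theorem sum_weight_succ (s s' : ℕ → ℝ) (G : ℝ → ℝ → ℕ → ℝ) (n : ℕ) :
    ∑ k ∈ Finset.range (n + 1), G (weight s (n + 1) k) (weight s' (n + 1) k) k =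
      ∑ k ∈ Finset.range n,
        G ((1 - s (n + 1)) * weight s n k) ((1 - s' (n + 1)) * weight s' n k) k +
      G (s (n + 1)) (s' (n + 1)) n := by
  rw [Finset.sum_range_succ]
  congr 1
  · refine Finset.sum_congr rfl fun k hk ↦ ?_
    simp only [weight, if_neg (Finset.mem_range.1 hk).ne]
  · simp only [weight, if_true]

theorem sum_weight_mul_succ (s q : ℕ → ℝ) (n : ℕ) :
    ∑ k ∈ Finset.range (n + 1), weight s (n + 1) k * q k =
      (1 - s (n + 1)) * ∑ k ∈ Finset.range n, weight s n k * q k + s (n + 1) * q n := by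
  rw [sum_weight_succ s s (fun w _ k ↦ w * q k), Finset.mul_sum]
  simp only [mul_assoc]

theorem aEst_eq_sum {Ω : Type*} (K : ℝ → ℝ) (h : ℕ → ℝ) (x : ℝ) (βs : ℕ → ℝ) (X Y : ℕ → Ω → ℝ)
    (n : ℕ) (ω : Ω) : aEst K h x βs X Y n ω =
      ∑ k ∈ Finset.range n, weight βs n k * kernelTerm K h x X Y 1 k ω := by
  induction n with
  | zero => simp [aEst]
  | succ n ih =>
    rw [sum_weight_mul_succ βs (fun k ↦ kernelTerm K h x X Y 1 k ω), ← ih, aEst, kernelTerm,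
      pow_one, mul_assoc (h (n + 1))⁻¹]

theorem fEst_eq_sum {Ω : Type*} (K : ℝ → ℝ) (h : ℕ → ℝ) (x : ℝ) (γs : ℕ → ℝ) (X Y : ℕ → Ω → ℝ)
    (n : ℕ) (ω : Ω) : fEst K h x γs X n ω =
      ∑ k ∈ Finset.range n, weight γs n k * kernelTerm K h x X Y 0 k ω := by
  induction n with
  | zero => simp [fEst]
  | succ n ih =>
    rw [sum_weight_mul_succ γs (fun k ↦ kernelTerm K h x X Y 0 k ω), ← ih, fEst, kernelTerm,
      pow_zero, one_mul]

namespace StepSize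

variable {ξ κ : ℝ} {s s' u q : ℕ → ℝ}

theorem tendsto_sum_weight_sub (hs : StepSize ξ s) (hu : GS κ u) {A w : ℝ}
    (hq : Tendsto (fun n ↦ (q n - A) / u (n + 1)) atTop (𝓝 w)) (hκ : 0 < 1 + κ * ξ) :
    Tendsto (fun n ↦ (∑ k ∈ Finset.range n, weight s n k * q k - A) / u n) atTop
      (𝓝 (w / (1 + κ * ξ))) := by
  refine hs.tendsto_div_of_rec hu (m := fun _ ↦ 1) (q := fun n ↦ q n - A)
    (Eventually.of_forall fun n ↦ ?_) tendsto_const_nhds hq hκ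
  rw [sum_weight_mul_succ]
  ring

theorem tendsto_sum_weight_mul_weight (hs : StepSize ξ s) (hs' : Tendsto s' atTop (𝓝 0))
    (hu : GS κ u) {ρ w : ℝ} (hρ : Tendsto (fun n ↦ s' n / s n) atTop (𝓝 ρ))
    (hq : Tendsto (fun n ↦ s' (n + 1) * q n / u (n + 1)) atTop (𝓝 w))
    (hκ : 0 < 1 + ρ + κ * ξ) :
    Tendsto (fun n ↦ (∑ k ∈ Finset.range n, weight s n k * weight s' n k * q k) / u n) atTop
      (𝓝 (w / (1 + ρ + κ * ξ))) := by
  refine hs.tendsto_div_of_rec hu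
    (m := fun n ↦ 1 + s' (n + 1) / s (n + 1) - s' (n + 1)) (q := fun n ↦ s' (n + 1) * q n)
    (Eventually.of_forall fun n ↦ ?_) ?_ hq hκ
  · have hsn := (hs.pos (n + 1) (by lia)).ne'
    have hdecay : 1 - s (n + 1) * (1 + s' (n + 1) / s (n + 1) - s' (n + 1)) =
        (1 - s (n + 1)) * (1 - s' (n + 1)) := by
      field_simp
      ring
    rw [sum_weight_succ s s' (fun w w' k ↦ w * w' * q k), hdecay, Finset.mul_sum, mul_assoc]
    congr! 2
    ring
  · have hρ' := (tendsto_add_atTop_iff_nat 1).2 hρ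
    simpa using (hρ'.const_add 1).sub ((tendsto_add_atTop_iff_nat 1).2 hs')

theorem tendsto_sum_weight_mul_weight_of_bandwidth {h : ℕ → ℝ} {ρ v w : ℝ} (hs : StepSize ξ s)
    (hs' : Tendsto s' atTop (𝓝 0)) (hu : GS κ u) (hpos : ∀ n, 1 ≤ n → 0 < h n)
    (hq : Tendsto (fun n ↦ h (n + 1) * q n) atTop (𝓝 v))
    (hρ : Tendsto (fun n ↦ s' n / s n) atTop (𝓝 ρ))
    (hw : Tendsto (fun n ↦ s' n * (h n)⁻¹ / u n) atTop (𝓝 w)) (hκ : 0 < 1 + ρ + κ * ξ) :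
    Tendsto (fun n ↦ (∑ k ∈ Finset.range n, weight s n k * weight s' n k * q k) / u n) atTop
      (𝓝 (w * v / (1 + ρ + κ * ξ))) := by
  refine hs.tendsto_sum_weight_mul_weight hs' hu hρ ?_ hκ
  refine (((tendsto_add_atTop_iff_nat 1).2 hw).mul hq).congr fun n ↦ ?_
  have := (hpos (n + 1) (by lia)).ne'
  field_simp

theorem tendsto_sum_abs_weight_cube (hs : StepSize ξ s) (hu : GS κ u)
    (hq : Tendsto (fun n ↦ s (n + 1) ^ 2 * q n / u (n + 1)) atTop (𝓝 0)) (hκ : 0 < 3 + κ * ξ) :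
    Tendsto (fun n ↦ (∑ k ∈ Finset.range n, |weight s n k| ^ 3 * q k) / u n) atTop (𝓝 0) := by
  have hs0 := (tendsto_add_atTop_iff_nat 1).2 hs.tendsto_zero
  rw [← zero_div (3 + κ * ξ)]
  refine hs.tendsto_div_of_rec hu (m := fun n ↦ 3 - 3 * s (n + 1) + s (n + 1) ^ 2)
    (q := fun n ↦ s (n + 1) ^ 2 * q n) ?_ ?_ hq hκ
  · filter_upwards [hs0.eventually (gt_mem_nhds one_pos)] with n hn
    have hdecay : 1 - s (n + 1) * (3 - 3 * s (n + 1) + s (n + 1) ^ 2) = (1 - s (n + 1)) ^ 3 := by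
      ring
    rw [sum_weight_succ s s (fun w _ k ↦ |w| ^ 3 * q k), hdecay, Finset.mul_sum,
      abs_of_pos (hs.pos (n + 1) (by lia))]
    refine congrArg₂ (· + ·) (Finset.sum_congr rfl fun k _ ↦ ?_) (by ring)
    rw [abs_mul, abs_of_pos (by linarith : 0 < 1 - s (n + 1))]
    ring
  · simpa using ((hs0.const_mul 3).const_sub 3).add (hs0.pow 2)

end StepSize

/-! ### Weighted kernel estimators -/

namespace KernelMoments

variable {Ω : Type*} [MeasurableSpace Ω] {P : Measure Ω} {T U : ℕ → Ω → ℝ} {h s u : ℕ → ℝ}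
  {A A₂ v ξ κ w : ℝ}

theorem tendsto_sum_integral (hT : KernelMoments P h T A A₂ v) (hpos : ∀ n, 1 ≤ n → 0 < h n)
    (hs : StepSize ξ s) (hu : GS κ u) (hw : Tendsto (fun n ↦ h n ^ 2 / u n) atTop (𝓝 w))
    (hκ : 0 < 1 + κ * ξ) :
    Tendsto (fun n ↦ (∑ k ∈ Finset.range n, weight s n k * ∫ ω, T k ω ∂P - A) / u n) atTop
      (𝓝 (A₂ * w / (1 + κ * ξ))) := by
  refine hs.tendsto_sum_weight_sub hu ?_ hκ
  refine (hT.mean.mul ((tendsto_add_atTop_iff_nat 1).2 hw)).congr fun n ↦ ?_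
  exact div_mul_div_cancel₀ (pow_ne_zero 2 (hpos (n + 1) (by lia)).ne')

theorem tendsto_sum_integral_abs_cube (hT : KernelMoments P h T A A₂ v)
    (hpos : ∀ n, 1 ≤ n → 0 < h n) (hs : StepSize ξ s) (hu : GS κ u)
    (hw : Tendsto (fun n ↦ (s n * (h n)⁻¹) ^ 2 / u n) atTop (𝓝 0)) (hκ : 0 < 3 + κ * ξ) :
    Tendsto (fun n ↦ (∑ k ∈ Finset.range n, |weight s n k| ^ 3 * ∫ ω, |T k ω| ^ 3 ∂P) / u n) atTop
      (𝓝 0) := by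
  obtain ⟨C, hC⟩ := hT.third
  refine hs.tendsto_sum_abs_weight_cube hu ?_ hκ
  have hlim := ((tendsto_add_atTop_iff_nat 1).2 hw).mul_const C
  rw [zero_mul] at hlim
  refine squeeze_zero (fun n ↦ ?_) (fun n ↦ ?_) hlim
  · have := (hu.1 (n + 1) (by lia)).le
    have : 0 ≤ ∫ ω, |T n ω| ^ 3 ∂P := integral_nonneg fun _ ↦ by positivity
    positivity
  · have hu' := hu.1 (n + 1) (by lia)
    have hh' := hpos (n + 1) (by lia)
    calc s (n + 1) ^ 2 * (∫ ω, |T n ω| ^ 3 ∂P) / u (n + 1)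
        = (s (n + 1) * (h (n + 1))⁻¹) ^ 2 / u (n + 1) *
            (h (n + 1) ^ 2 * ∫ ω, |T n ω| ^ 3 ∂P) := by
          field_simp
      _ ≤ (s (n + 1) * (h (n + 1))⁻¹) ^ 2 / u (n + 1) * C := by
          gcongr
          exact hC n

end KernelMoments

theorem KernelMoments.tendstoInMeasure_sum {Ω : Type*} [MeasurableSpace Ω] {P : Measure Ω}
    [IsProbabilityMeasure P] {T : ℕ → Ω → ℝ} {h s : ℕ → ℝ} {A A₂ v ξ : ℝ}
    (hT : KernelMoments P h T A A₂ v) (hind : iIndepFun T P) (hpos : ∀ n, 1 ≤ n → 0 < h n)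
    (hh : Tendsto h atTop (𝓝 0)) (hs : StepSize ξ s)
    (hsh : Tendsto (fun n ↦ s n * (h n)⁻¹) atTop (𝓝 0)) :
    TendstoInMeasure P (fun n ω ↦ ∑ k ∈ Finset.range n, weight s n k * T k ω) atTop
      (fun _ ↦ A) := by
  have hLp : ∀ n k, MemLp (fun ω ↦ weight s n k * T k ω) 2 P := fun n k ↦
    ((hT.memLp k).mono_exponent (by norm_num)).const_mul _
  refine tendstoInMeasure_of_tendsto_variance (fun n ↦ memLp_finsetSum _ fun k _ ↦ hLp n k) ?_ ?_
  · have hlim := hT.tendsto_sum_integral hpos hs (GS.const one_pos) (w := 0)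
      (by simpa using hh.pow 2) (by norm_num)
    simp only [div_one, mul_zero, zero_div] at hlim
    refine (tendsto_sub_nhds_zero_iff.1 hlim).congr fun n ↦ ?_
    rw [integral_finsetSum _ fun k _ ↦ (hLp n k).integrable (by norm_num)]
    simp only [integral_const_mul]
  · have hlim := hs.tendsto_sum_weight_mul_weight_of_bandwidth hs.tendsto_zero
      (GS.const one_pos) hpos hT.variance hs.tendsto_div_self (w := 0) (by simpa using hsh)
      (by norm_num)
    simp only [div_one, zero_mul, zero_div] at hlim
    refine hlim.congr fun n ↦ ?_
    have hpair : (↑(Finset.range n) : Set ℕ).Pairwise fun i j ↦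
        IndepFun (fun ω ↦ weight s n i * T i ω) (fun ω ↦ weight s n j * T j ω) P :=
      fun i _ j _ hij ↦ (hind.indepFun hij).comp (measurable_const_mul _) (measurable_const_mul _)
    rw [← Finset.sum_fn, IndepFun.variance_sum (fun k _ ↦ hLp n k) hpair]
    simp only [variance_const_mul, sq]

/-! ### The numerator of the estimation error -/

section Residual

variable {Ω : Type*} [MeasurableSpace Ω] {P : Measure Ω} {T U : ℕ → Ω → ℝ} {h s s' u : ℕ → ℝ}
  {r F A₂ F₂ vT vU vTU ξ ξ' ρ κ v w : ℝ}

/-- The `k`-th summand of `N_n - r D_n`, where `N_n` and `D_n` are the recursive averages of `T` and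
`U` with stepsizes `s` and `s'`. For `r = r(x)` this is the numerator of the estimation error
`N_n / D_n - r`. -/
def residual (s s' : ℕ → ℝ) (r : ℝ) (T U : ℕ → Ω → ℝ) (n k : ℕ) (ω : Ω) : ℝ :=
  weight s n k * T k ω - weight s' n k * r * U k ω

omit [MeasurableSpace Ω] in
theorem sum_residual (n : ℕ) (ω : Ω) :
    ∑ k ∈ Finset.range n, residual s s' r T U n k ω =
      ∑ k ∈ Finset.range n, weight s n k * T k ω -
        r * ∑ k ∈ Finset.range n, weight s' n k * U k ω := by
  simp only [residual, Finset.sum_sub_distrib, Finset.mul_sum]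
  congr! 2
  ring

theorem memLp_residual (hT : ∀ k, MemLp (T k) 3 P) (hU : ∀ k, MemLp (U k) 3 P) (n k : ℕ) :
    MemLp (residual s s' r T U n k) 3 P :=
  ((hT k).const_mul _).sub ((hU k).const_mul _)

theorem iIndepFun_residual (hind : iIndepFun (fun k ω ↦ (T k ω, U k ω)) P) (n : ℕ) :
    iIndepFun (residual s s' r T U n) P :=
  hind.comp (fun k p ↦ weight s n k * p.1 - weight s' n k * r * p.2) fun k ↦ by fun_prop

theorem tendsto_sum_integral_residual [IsFiniteMeasure P]
    (hT : KernelMoments P h T (r * F) A₂ vT)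
    (hU : KernelMoments P h U F F₂ vU) (hpos : ∀ n, 1 ≤ n → 0 < h n) (hs : StepSize ξ s)
    (hs' : StepSize ξ' s') (hu : GS κ u) (hw : Tendsto (fun n ↦ h n ^ 2 / u n) atTop (𝓝 w))
    (hκ : 0 < 1 + κ * ξ) (hκ' : 0 < 1 + κ * ξ') :
    Tendsto (fun n ↦ (∑ k ∈ Finset.range n, ∫ ω, residual s s' r T U n k ω ∂P) / u n) atTop
      (𝓝 (w * (A₂ / (1 + κ * ξ) - r * (F₂ / (1 + κ * ξ'))))) := by
  have hlim := (hT.tendsto_sum_integral hpos hs hu hw hκ).sub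
    ((hU.tendsto_sum_integral hpos hs' hu hw hκ').const_mul r)
  refine (hlim.congr fun n ↦ ?_).trans_eq (by ring_nf)
  have hint : ∀ k, ∫ ω, residual s s' r T U n k ω ∂P =
      weight s n k * ∫ ω, T k ω ∂P - r * (weight s' n k * ∫ ω, U k ω ∂P) := fun k ↦ by
    simp only [residual]
    rw [integral_sub (((hT.memLp k).integrable (by norm_num)).const_mul _)
      (((hU.memLp k).integrable (by norm_num)).const_mul _), integral_const_mul, integral_const_mul]
    ring
  simp only [hint, Finset.sum_sub_distrib, ← Finset.mul_sum]
  ring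

theorem variance_residual [IsProbabilityMeasure P] (hT : ∀ k, MemLp (T k) 2 P)
    (hU : ∀ k, MemLp (U k) 2 P) (n k : ℕ) :
    Var[residual s s' r T U n k; P] = weight s n k * weight s n k * Var[T k; P] -
      2 * r * (weight s n k * weight s' n k * cov[T k, U k; P]) +
      r ^ 2 * (weight s' n k * weight s' n k * Var[U k; P]) := by
  unfold residual
  rw [variance_fun_sub ((hT k).const_mul _) ((hU k).const_mul _), variance_const_mul,
    variance_const_mul, covariance_const_mul_left, covariance_const_mul_right]
  ring

theorem tendsto_sum_variance_residual [IsProbabilityMeasure P]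
    (hT : KernelMoments P h T (r * F) A₂ vT) (hU : KernelMoments P h U F F₂ vU)
    (hTU : Tendsto (fun k ↦ h (k + 1) * cov[T k, U k; P]) atTop (𝓝 vTU))
    (hpos : ∀ n, 1 ≤ n → 0 < h n) (hs : StepSize ξ s) (hs' : StepSize ξ' s')
    (hρ : Tendsto (fun n ↦ s' n / s n) atTop (𝓝 ρ)) (hu : GS κ u)
    (hw : Tendsto (fun n ↦ s n * (h n)⁻¹ / u n) atTop (𝓝 w))
    (hκ : 0 < 2 + κ * ξ) (hκρ : 0 < 1 + ρ + κ * ξ) (hκ' : 0 < 2 + κ * ξ') :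
    Tendsto (fun n ↦ (∑ k ∈ Finset.range n, Var[residual s s' r T U n k; P]) / u n) atTop
      (𝓝 (w * (vT / (2 + κ * ξ) - 2 * r * (ρ * vTU / (1 + ρ + κ * ξ)) +
        r ^ 2 * (ρ * vU / (2 + κ * ξ'))))) := by
  have hw' : Tendsto (fun n ↦ s' n * (h n)⁻¹ / u n) atTop (𝓝 (ρ * w)) := by
    refine (hρ.mul hw).congr' ?_
    filter_upwards [eventually_ge_atTop 1] with n hn
    have := (hs.pos n hn).ne'
    field_simp
  rw [← one_add_one_eq_two] at hκ hκ'
  have hlim := ((hs.tendsto_sum_weight_mul_weight_of_bandwidth hs.tendsto_zero hu hpos hT.variance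
      hs.tendsto_div_self hw hκ).sub
    ((hs.tendsto_sum_weight_mul_weight_of_bandwidth hs'.tendsto_zero hu hpos hTU hρ hw'
      hκρ).const_mul (2 * r))).add
    ((hs'.tendsto_sum_weight_mul_weight_of_bandwidth hs'.tendsto_zero hu hpos hU.variance
      hs'.tendsto_div_self hw' hκ').const_mul (r ^ 2))
  refine (hlim.congr fun n ↦ ?_).trans_eq (by ring_nf)
  simp only [variance_residual (fun k ↦ (hT.memLp k).mono_exponent (by norm_num))
    (fun k ↦ (hU.memLp k).mono_exponent (by norm_num)), Finset.sum_add_distrib,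
    Finset.sum_sub_distrib, ← Finset.mul_sum]
  ring

theorem integral_abs_residual_cube_le (hT : ∀ k, MemLp (T k) 3 P) (hU : ∀ k, MemLp (U k) 3 P)
    (n k : ℕ) :
    ∫ ω, |residual s s' r T U n k ω| ^ 3 ∂P ≤ 4 * (|weight s n k| ^ 3 * ∫ ω, |T k ω| ^ 3 ∂P) +
      4 * |r| ^ 3 * (|weight s' n k| ^ 3 * ∫ ω, |U k ω| ^ 3 ∂P) := by
  refine (integral_abs_sub_cube_le ((hT k).const_mul (weight s n k))
    ((hU k).const_mul (weight s' n k * r))).trans_eq ?_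
  simp only [abs_mul, mul_pow, integral_const_mul]
  ring

theorem tendsto_sum_integral_abs_residual_cube (hT : KernelMoments P h T (r * F) A₂ vT)
    (hU : KernelMoments P h U F F₂ vU) (hpos : ∀ n, 1 ≤ n → 0 < h n) (hs : StepSize ξ s)
    (hs' : StepSize ξ' s') (hρ : Tendsto (fun n ↦ s' n / s n) atTop (𝓝 ρ)) (hu : GS κ u)
    (hw : Tendsto (fun n ↦ (s n * (h n)⁻¹) ^ 2 / u n) atTop (𝓝 0))
    (hκ : 0 < 3 + κ * ξ) (hκ' : 0 < 3 + κ * ξ') :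
    Tendsto (fun n ↦ (∑ k ∈ Finset.range n, ∫ ω, |residual s s' r T U n k ω| ^ 3 ∂P) / u n) atTop
      (𝓝 0) := by
  have hw' : Tendsto (fun n ↦ (s' n * (h n)⁻¹) ^ 2 / u n) atTop (𝓝 0) := by
    refine (((hρ.pow 2).mul hw).congr' ?_).trans_eq (by rw [mul_zero])
    filter_upwards [eventually_ge_atTop 1] with n hn
    have := (hs.pos n hn).ne'
    field_simp
  have hlim := ((hT.tendsto_sum_integral_abs_cube hpos hs hu hw hκ).const_mul 4).add
    ((hU.tendsto_sum_integral_abs_cube hpos hs' hu hw' hκ').const_mul (4 * |r| ^ 3))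
  simp only [mul_zero, add_zero] at hlim
  refine squeeze_zero' ?_ ?_ hlim
  all_goals filter_upwards [eventually_ge_atTop 1] with n hn
  · exact div_nonneg (Finset.sum_nonneg fun _ _ ↦ integral_nonneg fun _ ↦ by positivity)
      (hu.1 n hn).le
  · rw [← mul_div_assoc, ← mul_div_assoc, ← add_div, Finset.mul_sum, Finset.mul_sum,
      ← Finset.sum_add_distrib]
    have := hu.1 n hn
    gcongr
    exact integral_abs_residual_cube_le hT.memLp hU.memLp n _

theorem tendstoInDistribution_sum_residual [IsProbabilityMeasure P]
    (hT : KernelMoments P h T (r * F) A₂ vT) (hU : KernelMoments P h U F F₂ vU)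
    (hTU : Tendsto (fun k ↦ h (k + 1) * cov[T k, U k; P]) atTop (𝓝 vTU))
    (hind : iIndepFun (fun k ω ↦ (T k ω, U k ω)) P) (hpos : ∀ n, 1 ≤ n → 0 < h n)
    (hs : StepSize ξ s) (hs' : StepSize ξ' s') (hρ : Tendsto (fun n ↦ s' n / s n) atTop (𝓝 ρ))
    (hu : GS κ u) (hu0 : Tendsto u atTop (𝓝 0))
    (hw : Tendsto (fun n ↦ h n ^ 2 / u n) atTop (𝓝 w))
    (hv : Tendsto (fun n ↦ s n * (h n)⁻¹ / u n ^ 2) atTop (𝓝 v))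
    (hκ : 0 < 1 + κ * ξ) (hκρ : 0 < 1 + ρ + 2 * κ * ξ) (hκ' : 0 < 1 + κ * ξ') :
    0 ≤ v * (vT / (2 + 2 * κ * ξ) - 2 * r * (ρ * vTU / (1 + ρ + 2 * κ * ξ)) +
        r ^ 2 * (ρ * vU / (2 + 2 * κ * ξ'))) ∧
      TendstoInDistribution (fun n ω ↦ (∑ k ∈ Finset.range n, residual s s' r T U n k ω) / u n)
        atTop (id : ℝ → ℝ) (fun _ ↦ P)
        (gaussianReal (w * (A₂ / (1 + κ * ξ) - r * (F₂ / (1 + κ * ξ'))))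
          (v * (vT / (2 + 2 * κ * ξ) - 2 * r * (ρ * vTU / (1 + ρ + 2 * κ * ξ)) +
            r ^ 2 * (ρ * vU / (2 + 2 * κ * ξ')))).toNNReal) := by
  have hvar := tendsto_sum_variance_residual hT hU hTU hpos hs hs' hρ (hu.pow 2) hv
    (by push_cast; linarith) (by push_cast; linarith) (by push_cast; linarith)
  have hcube : Tendsto (fun n ↦ (s n * (h n)⁻¹) ^ 2 / u n ^ 3) atTop (𝓝 0) := by
    refine (((hv.pow 2).mul hu0).congr' ?_).trans_eq (by rw [mul_zero])
    filter_upwards [eventually_ge_atTop 1] with n hn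
    have := (hu.1 n hn).ne'
    field_simp
  have hthird := tendsto_sum_integral_abs_residual_cube hT hU hpos hs hs' hρ (hu.pow 3) hcube
    (by push_cast; linarith) (by push_cast; linarith)
  push_cast at hvar
  exact ⟨nonneg_of_tendsto_sum_variance hvar,
    tendstoInDistribution_sum_div (iIndepFun_residual hind) (memLp_residual hT.memLp hU.memLp)
      (eventually_atTop.2 ⟨1, hu.1⟩)
      (tendsto_sum_integral_residual hT hU hpos hs hs' hu hw hκ hκ') hvar hthird⟩

end Residual

/-! ### The limit law of the semi-recursive estimator -/

/-- The mean of the limit law of `(r_n(x) - r(x)) / u_n` when `u ∈ GS(κ)` and `h_n² / u_n → w`. -/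
def limitMean (K : ℝ → ℝ) (g : ℝ → ℝ → ℝ) (ξ κ w x : ℝ) : ℝ :=
  w / dens g x * (iteratedDeriv 2 (afun g) x / 2 * kernelMoment 2 K / (1 + κ * ξ) -
    regr g x * (iteratedDeriv 2 (dens g) x / 2 * kernelMoment 2 K / (1 + κ)))

/-- The variance of the limit law of `(r_n(x) - r(x)) / u_n` when `u ∈ GS(κ)` and
`β_n h_n⁻¹ / u_n² → v`. -/
def limitVariance (K : ℝ → ℝ) (g : ℝ → ℝ → ℝ) (ξ κ v x : ℝ) : ℝ :=
  v / dens g x ^ 2 * (mom g 2 x * R K / (2 + 2 * κ * ξ) -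
    2 * regr g x * (ξ * (afun g x * R K) / (1 + ξ + 2 * κ * ξ)) +
    regr g x ^ 2 * (ξ * (dens g x * R K) / (2 + 2 * κ)))

theorem afun_eq_regr_mul_dens {g : ℝ → ℝ → ℝ} {x : ℝ} (hfx : dens g x ≠ 0) :
    afun g x = regr g x * dens g x := by
  rw [regr, div_mul_cancel₀ _ hfx]

theorem limitMean_eq_mul_biasConst (K : ℝ → ℝ) (g : ℝ → ℝ → ℝ) (a ξ w x : ℝ) :
    limitMean K g ξ (-2 * a) w x = w * biasConst K g a ξ x := by
  rw [limitMean, biasConst]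
  ring

theorem limitVariance_zero (K : ℝ → ℝ) (g : ℝ → ℝ → ℝ) (ξ κ x : ℝ) :
    limitVariance K g ξ κ 0 x = 0 := by
  simp only [limitVariance, zero_div, zero_mul]

/- The two constants agree because `(1 - β) ξ = 0`: a stepsize of exponent `β < 1` decays more
slowly than `1 / n`. -/
theorem limitVariance_eq_varConst (K : ℝ → ℝ) {g : ℝ → ℝ → ℝ} {a ξ β x : ℝ} (hfx : dens g x ≠ 0)
    (hβξ : (1 - β) * ξ = 0) :
    limitVariance K g ξ ((a - β) / 2) 1 x = varConst K g a ξ β x := by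
  have hden : 1 + ξ + 2 * ((a - β) / 2) * ξ = 1 + a * ξ := by linear_combination hβξ
  have hlast : ξ / (2 + 2 * ((a - β) / 2)) = ξ / (1 + a) := by
    rcases mul_eq_zero.1 hβξ with h | h
    · congr 1
      linear_combination h
    · simp [h]
  rw [limitVariance, varConst, condSecondMoment, hden, afun_eq_regr_mul_dens hfx,
    mul_div_right_comm ξ (dens g x * R K) (2 + _), hlast,
    show 2 + 2 * ((a - β) / 2) * ξ = 2 - (β - a) * ξ by ring]
  field_simp
  ring

namespace IsSample

variable {Ω : Type*} [MeasurableSpace Ω] {P : Measure Ω} {X Y : ℕ → Ω → ℝ} {g : ℝ → ℝ → ℝ}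
  {K : ℝ → ℝ} {h βs γs : ℕ → ℝ} {x C : ℝ}

theorem measurable_fEst (hXY : IsSample P X Y g) (hK : Measurable K) (n : ℕ) :
    Measurable (fEst K h x γs X n) := by
  simp_rw [funext (fEst_eq_sum K h x γs X Y n)]
  exact Finset.measurable_fun_sum _ fun k _ ↦ (hXY.measurable_kernelTerm hK 0 k).const_mul _

theorem measurable_rEst (hXY : IsSample P X Y g) (hK : Measurable K) (n : ℕ) :
    Measurable (rEst K h x βs γs X Y n) := by
  have hN : Measurable (aEst K h x βs X Y n) := by
    simp_rw [funext (aEst_eq_sum K h x βs X Y n)]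
    exact Finset.measurable_fun_sum _ fun k _ ↦ (hXY.measurable_kernelTerm hK 1 k).const_mul _
  have hD := hXY.measurable_fEst (h := h) (x := x) (γs := γs) hK n
  exact Measurable.ite (hD (measurableSet_singleton 0).compl) (hN.div hD) measurable_const

variable [IsProbabilityMeasure P] {ξ κ v w : ℝ} {u : ℕ → ℝ}

theorem tendstoInMeasure_fEst (hXY : IsSample P X Y g) (hK : SecondOrderKernel K)
    (hM : ThirdMomentBound g C) (hf2 : TwiceDifferentiableAt (dens g) x)
    (hpos : ∀ n, 1 ≤ n → 0 < h n) (hh : Tendsto h atTop (𝓝 0)) (hγ : StepSize ξ γs)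
    (hγh : Tendsto (fun n ↦ γs n * (h n)⁻¹) atTop (𝓝 0)) :
    TendstoInMeasure P (fEst K h x γs X) atTop (fun _ ↦ dens g x) := by
  simp_rw [funext₂ (fEst_eq_sum K h x γs X Y)]
  exact (hXY.kernelMoments hK hM hpos hh zero_le_one hf2 hf2.continuousAt).tendstoInMeasure_sum
    ((hXY.iIndepFun_kernelTerm hK.measurable 0 0).comp (fun _ p ↦ p.1) fun _ ↦ measurable_fst)
    hpos hh hγ hγh

theorem tendstoInDistribution_sum_residual (hXY : IsSample P X Y g) (hK : SecondOrderKernel K)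
    (hM : ThirdMomentBound g C) (hc : ContinuousAt (mom g 2) x) (hfx : 0 < dens g x)
    (hf2 : TwiceDifferentiableAt (dens g) x) (ha2 : TwiceDifferentiableAt (afun g) x)
    (hpos : ∀ n, 1 ≤ n → 0 < h n) (hh : Tendsto h atTop (𝓝 0)) (hβ : StepSize ξ βs)
    (hu : GS κ u) (hu0 : Tendsto u atTop (𝓝 0))
    (hw : Tendsto (fun n ↦ h n ^ 2 / u n) atTop (𝓝 w))
    (hv : Tendsto (fun n ↦ βs n * (h n)⁻¹ / u n ^ 2) atTop (𝓝 v))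
    (hκξ : 0 < 1 + κ * ξ) (hκ : 0 < 1 + κ) :
    0 ≤ limitVariance K g ξ κ v x ∧
      TendstoInDistribution
        (fun n ω ↦ (∑ k ∈ Finset.range n, residual βs (fun k ↦ (k : ℝ)⁻¹) (regr g x)
          (kernelTerm K h x X Y 1) (kernelTerm K h x X Y 0) n k ω) / (dens g x * u n))
        atTop (id : ℝ → ℝ) (fun _ ↦ P)
        (gaussianReal (limitMean K g ξ κ w x) (limitVariance K g ξ κ v x).toNNReal) := by
  have hT := hXY.kernelMoments hK hM hpos hh le_rfl ha2 hc
  have hU := hXY.kernelMoments hK hM hpos hh zero_le_one hf2 hf2.continuousAt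
  have hTU := hXY.tendsto_covariance_kernelTerm hK hM hpos hh le_rfl zero_le_one ha2.continuousAt
    hf2.continuousAt ha2.continuousAt
  have hA : mom g 1 x = regr g x * mom g 0 x := afun_eq_regr_mul_dens hfx.ne'
  rw [hA] at hT
  have hρ : Tendsto (fun n : ℕ ↦ (n : ℝ)⁻¹ / βs n) atTop (𝓝 ξ) := by
    simpa only [mul_inv, div_eq_mul_inv] using hβ.tendsto_inv
  have hu' : GS κ (fun n ↦ dens g x * u n) := by simpa only [zero_add] using (GS.const hfx).mul hu
  have hu0' : Tendsto (fun n ↦ dens g x * u n) atTop (𝓝 0) := by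
    simpa only [mul_zero] using hu0.const_mul (dens g x)
  have hw' : Tendsto (fun n ↦ h n ^ 2 / (dens g x * u n)) atTop (𝓝 (w / dens g x)) :=
    (hw.div_const (dens g x)).congr fun n ↦ by rw [div_div, mul_comm]
  have hv' : Tendsto (fun n ↦ βs n * (h n)⁻¹ / (dens g x * u n) ^ 2) atTop
      (𝓝 (v / dens g x ^ 2)) :=
    (hv.div_const (dens g x ^ 2)).congr fun n ↦ by rw [div_div, mul_pow, mul_comm (dens g x ^ 2)]
  have hκρ : 0 < 1 + ξ + 2 * κ * ξ := by nlinarith [mul_nonneg hβ.nonneg hκ.le]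
  have hclt := SemiRec.tendstoInDistribution_sum_residual hT hU hTU
    (hXY.iIndepFun_kernelTerm hK.measurable 1 0) hpos hβ stepSize_inv_natCast hρ hu' hu0' hw' hv'
    hκξ hκρ (by rwa [mul_one])
  simp only [mul_one] at hclt
  exact hclt

theorem tendstoInDistribution_rEst (hXY : IsSample P X Y g) (hK : SecondOrderKernel K)
    (hM : ThirdMomentBound g C) (hc : ContinuousAt (mom g 2) x) (hfx : 0 < dens g x)
    (hf2 : TwiceDifferentiableAt (dens g) x) (ha2 : TwiceDifferentiableAt (afun g) x)
    (hpos : ∀ n, 1 ≤ n → 0 < h n) (hh : Tendsto h atTop (𝓝 0)) (hβ : StepSize ξ βs)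
    (hu : GS κ u) (hu0 : Tendsto u atTop (𝓝 0))
    (hw : Tendsto (fun n ↦ h n ^ 2 / u n) atTop (𝓝 w))
    (hv : Tendsto (fun n ↦ βs n * (h n)⁻¹ / u n ^ 2) atTop (𝓝 v))
    (hκξ : 0 < 1 + κ * ξ) (hκ : 0 < 1 + κ) :
    0 ≤ limitVariance K g ξ κ v x ∧
      TendstoInDistribution
        (fun n ω ↦ (rEst K h x βs (fun k ↦ (k : ℝ)⁻¹) X Y n ω - regr g x) / u n)
        atTop (id : ℝ → ℝ) (fun _ ↦ P)
        (gaussianReal (limitMean K g ξ κ w x) (limitVariance K g ξ κ v x).toNNReal) := by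
  have hsum := hXY.tendstoInDistribution_sum_residual hK hM hc hfx hf2 ha2 hpos hh hβ hu hu0 hw hv
    hκξ hκ
  have hγh : Tendsto (fun n : ℕ ↦ (n : ℝ)⁻¹ * (h n)⁻¹) atTop (𝓝 0) := by
    refine ((hβ.tendsto_inv.mul (hv.mul (hu0.pow 2))).congr' ?_).trans_eq (by simp)
    filter_upwards [eventually_ge_atTop 1] with n hn
    have := (hu.1 n hn).ne'
    have := (hβ.pos n hn).ne'
    field_simp
  have hD := hXY.tendstoInMeasure_fEst hK hM hf2 hpos hh stepSize_inv_natCast hγh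
  refine ⟨hsum.1, tendstoInDistribution_mul_div hfx.ne' hsum.2 hD
    (fun n ↦ (hXY.measurable_fEst hK.measurable n).aemeasurable)
    (fun n ↦ (((hXY.measurable_rEst hK.measurable n).sub_const _).div_const _).aemeasurable)
    fun n ω hne ↦ ?_⟩
  rw [sum_residual, ← aEst_eq_sum, ← fEst_eq_sum, rEst, if_pos hne]
  generalize fEst K h x _ X n ω = D at hne ⊢
  have := hfx.ne'
  field_simp

end IsSample

/-! ### The two bandwidth regimes -/

theorem A2.min_mul_lt_one {β a ξ : ℝ} {βs h : ℕ → ℝ} (hA : A2 β a βs h)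
    (hξ : Tendsto (fun n : ℕ ↦ ((n : ℝ) * βs n)⁻¹) atTop (𝓝 ξ)) :
    min (2 * a) ((β - a) / 2) * ξ < 1 := by
  rcases hA.limit with ⟨L, hL, hlim⟩ | hlim
  · have hLξ : L * ξ = 1 := by
      refine tendsto_nhds_unique (hlim.mul hξ) (tendsto_const_nhds.congr' ?_)
      filter_upwards [eventually_ge_atTop 1] with n hn
      have := hA.step.1 n hn
      rw [mul_inv_cancel₀ (by positivity)]
    have hξ0 : 0 ≤ ξ := ge_of_tendsto hξ <| by
      filter_upwards [eventually_ge_atTop 1] with n hn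
      have := hA.step.1 n hn
      positivity
    have hξne : ξ ≠ 0 := right_ne_zero_of_mul_eq_one hLξ
    exact (mul_lt_mul_of_pos_right hL (hξ0.lt_of_ne' hξne)).trans_eq hLξ
  · rw [tendsto_nhds_unique hξ (tendsto_inv_atTop_zero.comp hlim), mul_zero]
    exact one_pos

namespace GS

variable {β a ξ : ℝ} {βs h : ℕ → ℝ}

theorem inv_natCast_mul (hβs : GS (-β) βs) : GS (β - 1) (fun n ↦ ((n : ℝ) * βs n)⁻¹) := by
  have := gs_inv_natCast.mul hβs.inv
  simp only [← mul_inv] at this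
  convert this using 1
  ring

theorem le_one (hβs : GS (-β) βs)
    (hξ : Tendsto (fun n : ℕ ↦ ((n : ℝ) * βs n)⁻¹) atTop (𝓝 ξ)) : β ≤ 1 := by
  linarith [hβs.inv_natCast_mul.nonpos_of_tendsto hξ]

theorem one_sub_mul_eq_zero (hβs : GS (-β) βs)
    (hξ : Tendsto (fun n : ℕ ↦ ((n : ℝ) * βs n)⁻¹) atTop (𝓝 ξ)) : (1 - β) * ξ = 0 := by
  rcases eq_or_ne ξ 0 with rfl | hne
  · exact mul_zero _
  · linear_combination -ξ * hβs.inv_natCast_mul.eq_zero_of_tendsto hξ hne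

theorem inv_mul_pow_five (hβs : GS (-β) βs) (hh : GS (-a) h) :
    GS (β - 5 * a) (fun n ↦ (βs n)⁻¹ * h n ^ 5) := by
  convert hβs.inv.mul (hh.pow 5) using 1
  push_cast
  ring

theorem sqrt_mul_inv (hβs : GS (-β) βs) (hh : GS (-a) h) :
    GS ((a - β) / 2) (fun n ↦ √(βs n * (h n)⁻¹)) := by
  convert (hβs.mul hh.inv).sqrt using 1
  ring

end GS

namespace IsSample

variable {Ω : Type*} [MeasurableSpace Ω] {P : Measure Ω} [IsProbabilityMeasure P]
  {X Y : ℕ → Ω → ℝ} {g : ℝ → ℝ → ℝ} {K : ℝ → ℝ} {h βs : ℕ → ℝ} {β a ξ x C : ℝ}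

theorem tendstoInDistribution_sqrt_mul_rEst_sub (hXY : IsSample P X Y g)
    (hK : SecondOrderKernel K) (hM : ThirdMomentBound g C) (hcont : ContinuousAt (mom g 2) x)
    (hfx : 0 < dens g x) (hf2 : TwiceDifferentiableAt (dens g) x)
    (ha2 : TwiceDifferentiableAt (afun g) x) (hβs : GS (-β) βs) (hh : GS (-a) h) (ha : 0 < a)
    (hξ : Tendsto (fun n : ℕ ↦ ((n : ℝ) * βs n)⁻¹) atTop (𝓝 ξ))
    (hmin : min (2 * a) ((β - a) / 2) * ξ < 1) {c : ℝ}
    (hc : Tendsto (fun n ↦ (βs n)⁻¹ * h n ^ 5) atTop (𝓝 c))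
    (hinf : Tendsto (fun n ↦ (βs n)⁻¹ * h n) atTop atTop) :
    0 ≤ varConst K g a ξ β x ∧
      TendstoInDistribution
        (fun n ω ↦ √((βs n)⁻¹ * h n) *
          (rEst K h x βs (fun k ↦ (k : ℝ)⁻¹) X Y n ω - regr g x))
        atTop (id : ℝ → ℝ) (fun _ ↦ P)
        (gaussianReal (√c * biasConst K g a ξ x) (varConst K g a ξ β x).toNNReal) := by
  have haβ : a ≤ β := by linarith [(hβs.inv.mul hh).nonneg_of_tendsto_atTop hinf]
  have hβa : β ≤ 5 * a := by linarith [(hβs.inv_mul_pow_five hh).nonpos_of_tendsto hc]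
  have hβ1 := hβs.le_one hξ
  rw [min_eq_right (by linarith)] at hmin
  have hu0 : Tendsto (fun n ↦ √(βs n * (h n)⁻¹)) atTop (𝓝 0) := by
    simpa [Function.comp_def, mul_comm] using (tendsto_inv_atTop_zero.comp hinf).sqrt
  have hw : Tendsto (fun n ↦ h n ^ 2 / √(βs n * (h n)⁻¹)) atTop (𝓝 √c) := by
    refine hc.sqrt.congr' ?_
    filter_upwards [eventually_ge_atTop 1] with n hn
    have := hh.1 n hn
    have := hβs.1 n hn
    rw [← Real.sqrt_sq (sq_nonneg (h n)), ← Real.sqrt_div' _ (by positivity)]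
    congr 1
    field_simp
  have hv : Tendsto (fun n ↦ βs n * (h n)⁻¹ / √(βs n * (h n)⁻¹) ^ 2) atTop (𝓝 1) := by
    refine tendsto_const_nhds.congr' ?_
    filter_upwards [eventually_ge_atTop 1] with n hn
    have := hh.1 n hn
    have := hβs.1 n hn
    rw [Real.sq_sqrt (by positivity), div_self (by positivity)]
  have hmean : limitMean K g ξ ((a - β) / 2) √c x = √c * biasConst K g a ξ x := by
    rcases eq_or_ne c 0 with rfl | hc0
    · simp [limitMean]
    · rw [← limitMean_eq_mul_biasConst]
      congr 1
      linarith [(hβs.inv_mul_pow_five hh).eq_zero_of_tendsto hc hc0]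
  obtain ⟨hnonneg, hclt⟩ := hXY.tendstoInDistribution_rEst hK hM hcont hfx hf2 ha2 hh.1
    (hh.tendsto_zero_of_neg (by linarith))
    ⟨hβs.1, hβs.tendsto_zero_of_neg (by linarith), hξ⟩ (hβs.sqrt_mul_inv hh) hu0 hw hv
    (by linarith) (by linarith)
  rw [limitVariance_eq_varConst K hfx.ne' (hβs.one_sub_mul_eq_zero hξ)] at hnonneg hclt
  rw [hmean] at hclt
  refine ⟨hnonneg, hclt.congr (fun n ↦ Eventually.of_forall fun ω ↦ ?_) .rfl⟩
  simp only [div_eq_inv_mul, ← Real.sqrt_inv, mul_inv, inv_inv]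

theorem tendstoInMeasure_inv_sq_mul_rEst_sub (hXY : IsSample P X Y g)
    (hK : SecondOrderKernel K) (hM : ThirdMomentBound g C) (hcont : ContinuousAt (mom g 2) x)
    (hfx : 0 < dens g x) (hf2 : TwiceDifferentiableAt (dens g) x)
    (ha2 : TwiceDifferentiableAt (afun g) x) (hβs : GS (-β) βs) (hh : GS (-a) h) (ha : 0 < a)
    (hξ : Tendsto (fun n : ℕ ↦ ((n : ℝ) * βs n)⁻¹) atTop (𝓝 ξ))
    (hmin : min (2 * a) ((β - a) / 2) * ξ < 1)
    (hinf : Tendsto (fun n ↦ (βs n)⁻¹ * h n ^ 5) atTop atTop) :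
    TendstoInMeasure P
      (fun n ω ↦ (h n ^ 2)⁻¹ * (rEst K h x βs (fun k ↦ (k : ℝ)⁻¹) X Y n ω - regr g x))
      atTop (fun _ ↦ biasConst K g a ξ x) := by
  have hβa : 5 * a ≤ β := by linarith [(hβs.inv_mul_pow_five hh).nonneg_of_tendsto_atTop hinf]
  have hβ1 := hβs.le_one hξ
  rw [min_eq_left (by linarith)] at hmin
  have hh0 := hh.tendsto_zero_of_neg (by linarith)
  have hu : GS (-2 * a) (fun n ↦ h n ^ 2) := by
    convert hh.pow 2 using 1
    push_cast
    ring
  have hw : Tendsto (fun n ↦ h n ^ 2 / h n ^ 2) atTop (𝓝 1) := by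
    refine tendsto_const_nhds.congr' ?_
    filter_upwards [eventually_ge_atTop 1] with n hn using (div_self (hu.1 n hn).ne').symm
  have hv : Tendsto (fun n ↦ βs n * (h n)⁻¹ / (h n ^ 2) ^ 2) atTop (𝓝 0) := by
    refine (tendsto_inv_atTop_zero.comp hinf).congr fun n ↦ ?_
    simp only [Function.comp_apply, mul_inv, inv_inv]
    ring
  have hclt := (hXY.tendstoInDistribution_rEst hK hM hcont hfx hf2 ha2 hh.1 hh0
    ⟨hβs.1, hβs.tendsto_zero_of_neg (by linarith), hξ⟩ hu (by simpa using hh0.pow 2) hw hv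
    (by linarith) (by linarith)).2
  simp only [limitVariance_zero, limitMean_eq_mul_biasConst, one_mul, Real.toNNReal_zero,
    gaussianReal_zero_var] at hclt
  simpa only [div_eq_inv_mul] using tendstoInMeasure_of_tendstoInDistribution_dirac hclt

end IsSample

end SemiRec

end

theorem theorem1_general {Ω : Type*} [MeasurableSpace Ω] {P : Measure Ω} [IsProbabilityMeasure P]
    {X Y : ℕ → Ω → ℝ} {g : ℝ → ℝ → ℝ} (hXY : SemiRec.IsSample P X Y g)
    {K : ℝ → ℝ} {β a ξ : ℝ} {βs h : ℕ → ℝ} {x C : ℝ}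
    (hK : SemiRec.SecondOrderKernel K) (hM : SemiRec.ThirdMomentBound g C)
    (hcont : ContinuousAt (SemiRec.mom g 2) x) (hfx : 0 < SemiRec.dens g x)
    (hf2 : SemiRec.TwiceDifferentiableAt (SemiRec.dens g) x)
    (ha2 : SemiRec.TwiceDifferentiableAt (SemiRec.afun g) x)
    (hβs : SemiRec.GS (-β) βs) (hh : SemiRec.GS (-a) h) (ha : 0 < a)
    (hξ : Tendsto (fun n : ℕ ↦ ((n : ℝ) * βs n)⁻¹) atTop (𝓝 ξ))
    (hmin : min (2 * a) ((β - a) / 2) * ξ < 1) :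
    (∀ c : ℝ, Tendsto (fun n ↦ (βs n)⁻¹ * h n ^ 5) atTop (𝓝 c) →
      Tendsto (fun n ↦ (βs n)⁻¹ * h n) atTop atTop →
      0 ≤ SemiRec.varConst K g a ξ β x ∧
      TendstoInDistribution
        (fun n ω ↦ √((βs n)⁻¹ * h n) *
          (SemiRec.rEst K h x βs (fun k ↦ (k : ℝ)⁻¹) X Y n ω - SemiRec.regr g x))
        atTop (id : ℝ → ℝ) (fun _ ↦ P)
        (gaussianReal (√c * SemiRec.biasConst K g a ξ x)
          (SemiRec.varConst K g a ξ β x).toNNReal)) ∧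
    (Tendsto (fun n ↦ (βs n)⁻¹ * h n ^ 5) atTop atTop →
      TendstoInMeasure P
        (fun n ω ↦ (h n ^ 2)⁻¹ *
          (SemiRec.rEst K h x βs (fun k ↦ (k : ℝ)⁻¹) X Y n ω - SemiRec.regr g x))
        atTop (fun _ ↦ SemiRec.biasConst K g a ξ x)) :=
  ⟨fun _ ↦ hXY.tendstoInDistribution_sqrt_mul_rEst_sub hK hM hcont hfx hf2 ha2 hβs hh ha hξ hmin,
    hXY.tendstoInMeasure_inv_sq_mul_rEst_sub hK hM hcont hfx hf2 ha2 hβs hh ha hξ hmin⟩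

theorem theorem1 {Ω : Type*} [MeasurableSpace Ω] (P : Measure Ω) [IsProbabilityMeasure P]
    (X Y : ℕ → Ω → ℝ) (g : ℝ → ℝ → ℝ) (hXY : SemiRec.IsSample P X Y g)
    (K : ℝ → ℝ) (β a ξ : ℝ) (βs h : ℕ → ℝ) (x : ℝ)
    (hA1 : SemiRec.A1 K) (hA2 : SemiRec.A2 β a βs h) (hA3 : SemiRec.A3 g x)
    (hfx : 0 < SemiRec.dens g x)
    (hf2 : SemiRec.TwiceDifferentiableAt (SemiRec.dens g) x)
    (ha2 : SemiRec.TwiceDifferentiableAt (SemiRec.afun g) x)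
    (hξ : Tendsto (fun n : ℕ => ((n : ℝ) * βs n)⁻¹) atTop (𝓝 ξ)) :
    (∀ c : ℝ, 0 ≤ c → Tendsto (fun n : ℕ => (βs n)⁻¹ * h n ^ 5) atTop (𝓝 c) →
      Tendsto (fun n : ℕ => (βs n)⁻¹ * h n) atTop atTop →
      0 ≤ SemiRec.varConst K g a ξ β x ∧
      TendstoInDistribution
        (fun (n : ℕ) (ω : Ω) => √((βs n)⁻¹ * h n) *
          (SemiRec.rEst K h x βs (fun k : ℕ => (k : ℝ)⁻¹) X Y n ω - SemiRec.regr g x))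
        atTop (id : ℝ → ℝ) (fun _ : ℕ => P)
        (gaussianReal (√c * SemiRec.biasConst K g a ξ x)
          (SemiRec.varConst K g a ξ β x).toNNReal)) ∧
    (Tendsto (fun n : ℕ => (βs n)⁻¹ * h n ^ 5) atTop atTop →
      TendstoInMeasure P
        (fun (n : ℕ) (ω : Ω) => (h n ^ 2)⁻¹ *
          (SemiRec.rEst K h x βs (fun k : ℕ => (k : ℝ)⁻¹) X Y n ω - SemiRec.regr g x))
        atTop (fun _ : Ω => SemiRec.biasConst K g a ξ x)) := by
  obtain ⟨C, hM⟩ := hA3.exists_thirdMomentBound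
  obtain ⟨hclt, hbias⟩ := theorem1_general hXY hA1.secondOrderKernel hM (hA3.cont_mom 2 le_rfl)
    hfx hf2 ha2 hA2.step hA2.bandwidth hA2.a_pos hξ (hA2.min_mul_lt_one hξ)
  exact ⟨fun c _ ↦ hclt c, hbias⟩
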